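/- Let $K$ be a field and let $S = K[X_1,\ldots,X_d,Y_1,\ldots,Y_b,Z_1,\ldots,Z_c]$ be $\mathbb{Z}^3$-graded by $\deg K = (0,0,0)$, $\deg X_i = (0,0,1)$, $\deg Y_j = (0,1,h_j)$ and $\deg Z_k = (1,0,g_k)$, where $h_j, g_k \in \mathbb{Z}$, $h_1 \ge \cdots \ge h_b$ and $g_1 \ge \cdots \ge g_c$. (If $b=0$, resp. $c=0$, let $h_1$, resp. $g_1$, be an arbitrary integer.) Let $L = \bigoplus_{(i,n,a)\in\mathbb{Z}^3} L_{(i,n,a)}$ be a finitely generated $\mathbb{Z}^3$-graded $S$-module with a finite $\mathbb{Z}^3$-graded free resolution $$0 \to F_N \to \cdots \to F_1 \to F_0 \to L \to 0, \qquad F_l = \bigoplus_p S(-b_{pl1},-b_{pl2},-a_{pl}) \text{ (a finite direct sum)},$$ and set $$c_l = \max_p\{a_{pl} - g_1 b_{pl1} - h_1 b_{pl2}\} \quad (0 \le l \le N), \qquad e = \max\{c_l - l : 0 \le l \le N\},$$ where the maximum of the empty set is $-\infty$. For $(i,n)\in\mathbb{Z}^2$ let $L_{(i,n,\star)} = \bigoplus_{a\in\mathbb{Z}}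 L_{(i,n,a)}$, a $\mathbb{Z}$-graded module over $Q = K[X_1,\ldots,X_d]$, $\deg X_i = 1$. Then $$\operatorname{reg}_Q\bigl(L_{(i,n,\star)}\bigr) \le g_1\, i + h_1\, n + e \quad \text{for all } (i,n) \in \mathbb{Z}^2.$$ Here, with $Q_+ = (X_1,\ldots,X_d)$, the regularity of a $\mathbb{Z}$-graded $Q$-module $M$ is $\operatorname{reg}_Q(M) = \sup\{a_p(M) + p : p \ge 0\}$, where $a_p(M) = \sup\{\mu : H^p_{Q_+}(M)_\mu \ne 0\}$ ($-\infty$ if $H^p_{Q_+}(M) = 0$), and $H^p_{Q_+}(M)$ is the $p$-th graded local cohomology module, that is, the $p$-th cohomology of the Čech complex of $M$ on $X_1,\ldots,X_d$. -/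

import Mathlib

noncomputable section

namespace Multigraded

open MvPolynomial

/-! ### Graded local cohomology and Castelnuovo-Mumford regularity over `Q = K[X_1, …, X_d]`

`M` is a `Q`-module and `𝓜 a` (`a : ℤ`) are its graded components, where `deg X_i = 1`.
Local cohomology with respect to `Q₊ = (X_1, …, X_d)`, with its grading, is the cohomology of the
Čech complex of `M` on `X_1, …, X_d`:
`0 → M → ⨁_i M_{X_i} → ⨁_{i<j} M_{X_i X_j} → ⋯ → M_{X_1 ⋯ X_d} → 0`. -/

section Regularity

variable (K : Type*) [Field K] {d : ℕ}

/-- The multiplicative set of all monomials in the variables `X_i`, `i ∈ σ`. Inverting it is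
the same as inverting the single element `∏ i ∈ σ, X_i`. -/
def monomialsOn (σ : Finset (Fin d)) : Submonoid (MvPolynomial (Fin d) K) where
  carrier := {q | ∃ u : Fin d →₀ ℕ, u.support ⊆ σ ∧ monomial u 1 = q}
  one_mem' := ⟨0, by simp, by simp⟩
  mul_mem' := by
    rintro _ _ ⟨u, hu, rfl⟩ ⟨v, hv, rfl⟩
    exact ⟨u + v, Finsupp.support_add.trans (Finset.union_subset hu hv),
      by rw [monomial_mul, one_mul]⟩

theorem monomialsOn_mono {σ τ : Finset (Fin d)} (h : σ ⊆ τ) :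
    monomialsOn K σ ≤ monomialsOn K τ := by
  rintro _ ⟨u, hu, rfl⟩
  exact ⟨u, hu.trans h, rfl⟩

variable (d) (M : Type*) [AddCommGroup M] [Module (MvPolynomial (Fin d) K) M]

/-- The `p`-th term `∏_{|σ| = p} M_{X_σ}` of the Čech complex, where `X_σ = ∏ i ∈ σ, X_i`. -/
abbrev CechCochain (p : ℕ) : Type _ :=
  (σ : {σ : Finset (Fin d) // σ.card = p}) → LocalizedModule (monomialsOn K σ.1) M

/-- The Čech differential:
`(δ x)_τ = ∑_{i ∈ τ} (-1)^{#{j ∈ τ : j < i}} (x_{τ ∖ {i}} restricted to M_{X_τ})`. -/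
def cechD (p : ℕ) :
    CechCochain K d M p →ₗ[MvPolynomial (Fin d) K] CechCochain K d M (p + 1) :=
  LinearMap.pi fun τ => ∑ i : {i // i ∈ τ.1},
    ((-1 : MvPolynomial (Fin d) K) ^ (τ.1.filter (· < i.1)).card) •
      (LocalizedModule.liftOfLE (monomialsOn K (τ.1.erase i.1)) (monomialsOn K τ.1)
          (monomialsOn_mono K (Finset.erase_subset i.1 τ.1))).comp
        (LinearMap.proj
          (⟨τ.1.erase i.1, by rw [Finset.card_erase_of_mem i.2, τ.2, Nat.add_sub_cancel]⟩ :
            {σ : Finset (Fin d) // σ.card = p}))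

/-- Čech `p`-coboundaries. -/
def cechB : (p : ℕ) → Submodule (MvPolynomial (Fin d) K) (CechCochain K d M p)
  | 0 => ⊥
  | p + 1 => LinearMap.range (cechD K d M p)

/-- The local cohomology module `H^p_{Q₊}(M)`: Čech cocycles modulo coboundaries. -/
abbrev LocalCohomology (p : ℕ) : Type _ :=
  LinearMap.ker (cechD K d M p) ⧸ (cechB K d M p).submoduleOf (LinearMap.ker (cechD K d M p))

variable {M} (𝓜 : ℤ → AddSubgroup M)

/-- The degree `μ` component of `M_{X_σ}`: it consists of the fractions `m / X^u`, with `X^u` a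
monomial in the variables `X_i`, `i ∈ σ`, and `m` homogeneous of degree `μ + |u|`. -/
def locComponent (σ : Finset (Fin d)) (μ : ℤ) :
    AddSubgroup (LocalizedModule (monomialsOn K σ) M) :=
  ⨆ (u : Fin d →₀ ℕ) (hu : u.support ⊆ σ),
    (𝓜 (μ + (u.degree : ℤ))).map
      ((LocalizedModule.divBy (⟨monomial u 1, u, hu, rfl⟩ : monomialsOn K σ)).comp
        (LocalizedModule.mkLinearMap (monomialsOn K σ) M)).toAddMonoidHom

/-- The degree `μ` component of the `p`-th term of the Čech complex. -/
def cechComponent (p : ℕ) (μ : ℤ) : AddSubgroup (CechCochain K d M p) :=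
  AddSubgroup.pi Set.univ fun σ => locComponent K d 𝓜 σ.1 μ

/-- The degree `μ` component `H^p_{Q₊}(M)_μ`: the classes of the homogeneous cocycles of
degree `μ`. -/
def localCohomologyComponent (p : ℕ) (μ : ℤ) : AddSubgroup (LocalCohomology K d M p) :=
  ((cechComponent K d 𝓜 p μ).comap (LinearMap.ker (cechD K d M p)).subtype.toAddMonoidHom).map
    ((cechB K d M p).submoduleOf (LinearMap.ker (cechD K d M p))).mkQ.toAddMonoidHom

/-- `a_p(M) = sup {μ : H^p_{Q₊}(M)_μ ≠ 0}`, which is `-∞` if `H^p_{Q₊}(M) = 0`. -/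
def aInvariant (p : ℕ) : EReal :=
  ⨆ (μ : ℤ) (_ : localCohomologyComponent K d 𝓜 p μ ≠ ⊥), ((μ : ℝ) : EReal)

/-- The Castelnuovo-Mumford regularity `reg_Q(M) = sup {a_p(M) + p : p ≥ 0}`. -/
def reg : EReal := ⨆ p : ℕ, aInvariant K d 𝓜 p + (p : EReal)

end Regularity

/-! ### The trigraded polynomial ring -/

section Trigraded

variable (K : Type*) [Field K] {d b c : ℕ}

/-- The polynomial ring `S = K[X_1, …, X_d, Y_1, …, Y_b, Z_1, …, Z_c]`. -/
abbrev TriPoly (d b c : ℕ) : Type _ := MvPolynomial (Fin d ⊕ Fin b ⊕ Fin c) K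

/-- The degrees `deg X_i = (0,0,1)`, `deg Y_j = (0,1,h_j)`, `deg Z_k = (1,0,g_k)`. -/
def triDegree (d : ℕ) (h : Fin b → ℤ) (g : Fin c → ℤ) : Fin d ⊕ Fin b ⊕ Fin c → ℤ × ℤ × ℤ
  | .inl _ => (0, 0, 1)
  | .inr (.inl j) => (0, 1, h j)
  | .inr (.inr k) => (1, 0, g k)

/-- The `ℤ³`-grading of `S`. -/
abbrev triGrading (d : ℕ) (h : Fin b → ℤ) (g : Fin c → ℤ) (ν : ℤ × ℤ × ℤ) :
    Submodule K (TriPoly K d b c) :=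
  weightedHomogeneousSubmodule K (triDegree d h g) ν

/-- The inclusion of `Q = K[X_1, …, X_d]` into `S`. -/
def inclX (d b c : ℕ) : MvPolynomial (Fin d) K →+* TriPoly K d b c :=
  (rename Sum.inl).toRingHom

variable {L : Type*} [AddCommGroup L] [Module (TriPoly K d b c) L]

/-- `L_{(i,n,⋆)} = ⨁_a L_{(i,n,a)}`, as a subgroup of `L`. -/
def strandSubgroup (𝓛 : ℤ × ℤ × ℤ → AddSubgroup L) (i n : ℤ) : AddSubgroup L :=
  ⨆ a : ℤ, 𝓛 (i, n, a)

theorem inclX_smul_mem (h : Fin b → ℤ) (g : Fin c → ℤ) (𝓛 : ℤ × ℤ × ℤ → AddSubgroup L)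
    [SetLike.GradedSMul (triGrading K d h g) 𝓛] (i n : ℤ) (q : MvPolynomial (Fin d) K)
    {x : L} (hx : x ∈ strandSubgroup 𝓛 i n) :
    inclX K d b c q • x ∈ strandSubgroup 𝓛 i n := by
  have key : ∀ (s : TriPoly K d b c) (a : ℤ), s ∈ triGrading K d h g (0, 0, a) →
      ∀ {x : L}, x ∈ strandSubgroup 𝓛 i n → s • x ∈ strandSubgroup 𝓛 i n := by
    intro s a hs x hx
    unfold strandSubgroup at hx ⊢
    induction hx using AddSubgroup.iSup_induction' with
    | hp a' x hx =>
      have := SetLike.GradedSMul.smul_mem hs hx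
      simp only [vadd_eq_add, Prod.mk_add_mk, zero_add] at this
      exact AddSubgroup.mem_iSup_of_mem (a + a') this
    | h1 => simp
    | hadd x y _ _ hx hy => rw [smul_add]; exact add_mem hx hy
  induction q using MvPolynomial.induction_on generalizing x with
  | C r =>
    refine key _ 0 ?_ hx
    have : inclX K d b c (C r) = C r := by simp [inclX]
    rw [this]
    exact isWeightedHomogeneous_C _ _
  | add p q hp hq => rw [map_add, add_smul]; exact add_mem (hp hx) (hq hx)
  | mul_X p j hp =>
    rw [map_mul, mul_smul]
    refine hp (key _ 1 ?_ hx)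
    have : inclX K d b c (X j) = X (Sum.inl j) := by simp [inclX]
    rw [this]
    exact isWeightedHomogeneous_X K (triDegree d h g) (Sum.inl j)

/-- `L_{(i,n,⋆)} = ⨁_a L_{(i,n,a)}` as a type; it carries the module structure over
`Q = K[X_1, …, X_d]` given by the inclusion of `Q` into `S`. -/
def Strand (d : ℕ) {b c : ℕ} {L : Type*} [AddCommGroup L]
    [Module (TriPoly K d b c) L] (_h : Fin b → ℤ) (_g : Fin c → ℤ) (𝓛 : ℤ × ℤ × ℤ → AddSubgroup L)
    [SetLike.GradedSMul (triGrading K d _h _g) 𝓛] (i n : ℤ) : Type _ :=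
  strandSubgroup 𝓛 i n

section

variable (d) (h : Fin b → ℤ) (g : Fin c → ℤ) (𝓛 : ℤ × ℤ × ℤ → AddSubgroup L)
  [SetLike.GradedSMul (triGrading K d h g) 𝓛] (i n : ℤ)

instance : AddCommGroup (Strand K d h g 𝓛 i n) :=
  inferInstanceAs (AddCommGroup (strandSubgroup 𝓛 i n))

instance : Module (MvPolynomial (Fin d) K) (Strand K d h g 𝓛 i n) where
  smul q x := ⟨inclX K d b c q • x.1, inclX_smul_mem K h g 𝓛 i n q x.2⟩
  one_smul x := Subtype.ext (by change inclX K d b c 1 • x.1 = x.1; simp)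
  mul_smul p q x := Subtype.ext (by
    change inclX K d b c (p * q) • x.1 = inclX K d b c p • inclX K d b c q • x.1
    rw [map_mul, mul_smul])
  smul_zero q := Subtype.ext (by change inclX K d b c q • (0 : L) = 0; simp)
  smul_add q x y := Subtype.ext (by
    change inclX K d b c q • (x.1 + y.1) = inclX K d b c q • x.1 + inclX K d b c q • y.1
    rw [smul_add])
  add_smul p q x := Subtype.ext (by
    change inclX K d b c (p + q) • x.1 = inclX K d b c p • x.1 + inclX K d b c q • x.1
    rw [map_add, add_smul])
  zero_smul x := Subtype.ext (by change inclX K d b c 0 • x.1 = 0; simp)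

/-- The `ℤ`-grading of `L_{(i,n,⋆)}`: the degree `a` component is `L_{(i,n,a)}`. -/
def strandGrading (a : ℤ) : AddSubgroup (Strand K d h g 𝓛 i n) :=
  (𝓛 (i, n, a)).comap (strandSubgroup 𝓛 i n).subtype

end

/-- The degree `ν` component of the graded free module `⨁_p S(-t_p)`, whose `p`-th basis vector
has degree `t_p`: the vectors whose `p`-th coordinate has degree `ν - t_p`. -/
def freeComponent (d : ℕ) (h : Fin b → ℤ) (g : Fin c → ℤ) {r : ℕ} (t : Fin r → ℤ × ℤ × ℤ)
    (ν : ℤ × ℤ × ℤ) : Set (Fin r → TriPoly K d b c) :=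
  {f | ∀ p, f p ∈ triGrading K d h g (ν - t p)}

/-- A finite `ℤ³`-graded free resolution `0 → F_N → ⋯ → F_1 → F_0 → L → 0` of `L` over `S`, where
`F_l = ⨁_p S(-b_{pl1}, -b_{pl2}, -a_{pl})` is a finite direct sum,
with `(b_{pl1}, b_{pl2}, a_{pl}) = twist l p`. -/
structure GradedFreeResolution (d : ℕ) {b c : ℕ} {L : Type*} [AddCommGroup L]
    [Module (TriPoly K d b c) L] (h : Fin b → ℤ) (g : Fin c → ℤ)
    (𝓛 : ℤ × ℤ × ℤ → AddSubgroup L) where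
  /-- the length `N` -/
  length : ℕ
  /-- the number of summands of `F_l` -/
  rank : ℕ → ℕ
  rank_eq_zero : ∀ l, length < l → rank l = 0
  /-- the twists of `F_l` -/
  twist : (l : ℕ) → Fin (rank l) → ℤ × ℤ × ℤ
  /-- the differential `F_{l+1} → F_l` -/
  φ : (l : ℕ) → (Fin (rank (l + 1)) → TriPoly K d b c) →ₗ[TriPoly K d b c]
    (Fin (rank l) → TriPoly K d b c)
  /-- the augmentation `F_0 → L` -/
  ε : (Fin (rank 0) → TriPoly K d b c) →ₗ[TriPoly K d b c] L
  φ_homogeneous : ∀ l ν, ∀ f ∈ freeComponent K d h g (twist (l + 1)) ν,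
    φ l f ∈ freeComponent K d h g (twist l) ν
  ε_homogeneous : ∀ ν, ∀ f ∈ freeComponent K d h g (twist 0) ν, ε f ∈ 𝓛 ν
  exact_φ : ∀ l, Function.Exact (φ (l + 1)) (φ l)
  exact_ε : Function.Exact (φ 0) ε
  surjective_ε : Function.Surjective ε

namespace GradedFreeResolution

variable {K} {h : Fin b → ℤ} {g : Fin c → ℤ} {𝓛 : ℤ × ℤ × ℤ → AddSubgroup L}

/-- `c_l = max_p {a_{pl} - g₁ b_{pl1} - h₁ b_{pl2}}`, which is `-∞` if `F_l = 0`. -/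
def cInvariant (F : GradedFreeResolution K d h g 𝓛) (g₁ h₁ : ℤ) (l : ℕ) : EReal :=
  Finset.univ.sup fun p : Fin (F.rank l) =>
    (((F.twist l p).2.2 - g₁ * (F.twist l p).1 - h₁ * (F.twist l p).2.1 : ℤ) : ℝ)

/-- `e = max {c_l - l : 0 ≤ l ≤ N}`. -/
def eInvariant (F : GradedFreeResolution K d h g 𝓛) (g₁ h₁ : ℤ) : EReal :=
  (Finset.range (F.length + 1)).sup fun l => F.cInvariant g₁ h₁ l - (l : EReal)

end GradedFreeResolution

end Trigraded

end Multigraded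

end

noncomputable section

/-! The bound on the regularity says that the degree `μ` part of `H^p` of the strand `L_{(i,n,⋆)}`
vanishes as soon as `μ + p > g₁ i + h₁ n + e`. This is proved for the graded free modules and
carried to `L` by dimension shifting.

For a summand `S(-b₁,-b₂,-a)`, split the Čech complex by Laurent exponents `w`; only the exponents
of the `X_k` can be negative. If some `X_j` has nonnegative exponent in `w`, then inserting or
removing `j` does not affect whether `w` occurs over `σ`, so this piece is a cone with apex `j` and
is contractible. If all exponents of the `X_k` are negative, then `w` occurs only over the full set
of variables, so `p = d`. Comparing degrees gives `μ - a ≤ -d + h₁ (n - b₂) + g₁ (i - b₁)`, since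
`h_j ≤ h₁` and `g_k ≤ g₁`. Hence the complex of `F_l` is acyclic at position `p` in degree `μ` once
`μ + p > c_l + g₁ i + h₁ n` (`cechAcyclic_free`).

Each Čech term is a product of localizations, hence exact in the module. So the vanishing of
`H^{p+l}(F_l)_μ` for all `l` gives that of `H^p(L)_μ`, through the syzygy modules taken from the end
of the resolution (`cech_decomposition_step`, `exists_cechMap_φ_eq`). The shift from `p` to `p + l`
is the reason for `c_l - l` in `e`. -/

namespace Multigraded

open MvPolynomial

/-! ### Signs and the alternating sum over subsets -/

section Sign

variable {d : ℕ}

/-- The sign `(-1)^{#{j ∈ τ : j < i}}` of the Čech differential. -/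
def cechSign (τ : Finset (Fin d)) (i : Fin d) : ℤ := (-1) ^ (τ.filter (· < i)).card

theorem cechSign_mul_self (τ : Finset (Fin d)) (i : Fin d) :
    cechSign τ i * cechSign τ i = 1 := by
  rw [cechSign, ← mul_pow]; simp

theorem cechSign_erase_self (τ : Finset (Fin d)) (i : Fin d) :
    cechSign (τ.erase i) i = cechSign τ i := by
  unfold cechSign
  congr 2
  ext k
  simp only [Finset.mem_filter, Finset.mem_erase]
  exact ⟨fun h => ⟨h.1.2, h.2⟩, fun h => ⟨⟨h.2.ne, h.1⟩, h.2⟩⟩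

theorem cechSign_erase_of_lt {τ : Finset (Fin d)} {i k : Fin d} (hi : i ∈ τ) (hik : i < k) :
    cechSign (τ.erase i) k = -cechSign τ k := by
  have h : ((τ.erase i).filter (· < k)).card + 1 = (τ.filter (· < k)).card := by
    have h1 : (τ.erase i).filter (· < k) = (τ.filter (· < k)).erase i := by
      ext j; simp only [Finset.mem_filter, Finset.mem_erase]; tauto
    rw [h1]
    exact Finset.card_erase_add_one (Finset.mem_filter.2 ⟨hi, hik⟩)
  rw [cechSign, cechSign, ← h, pow_succ]; ring

theorem cechSign_erase_of_le {τ : Finset (Fin d)} {i k : Fin d} (hik : k ≤ i) :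
    cechSign (τ.erase i) k = cechSign τ k := by
  unfold cechSign
  congr 2
  ext j
  simp only [Finset.mem_filter, Finset.mem_erase]
  exact ⟨fun h => ⟨h.1.2, h.2⟩, fun h => ⟨⟨(h.2.trans_le hik).ne, h.1⟩, h.2⟩⟩

theorem cechSign_mul_cechSign_erase {τ : Finset (Fin d)} {i k : Fin d} (hi : i ∈ τ) (hk : k ∈ τ)
    (hik : i ≠ k) :
    cechSign τ i * cechSign (τ.erase i) k = -(cechSign τ k * cechSign (τ.erase k) i) := by
  rcases lt_or_gt_of_ne hik with h | h
  · rw [cechSign_erase_of_lt hi h, cechSign_erase_of_le h.le]; ring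
  · rw [cechSign_erase_of_lt hk h, cechSign_erase_of_le h.le]; ring

/-- This is the exchange rule for removing `i` and `j` from `insert j τ`, rewritten with signs of
`τ`. It makes the terms match in the contraction `altSum_cone`. -/
theorem cechSign_mul_cechSign_of_notMem {τ : Finset (Fin d)} {i j : Fin d} (hi : i ∈ τ)
    (hj : j ∉ τ) :
    cechSign τ i * cechSign (τ.erase i) j = -(cechSign (insert j τ) i * cechSign τ j) := by
  have hij : i ≠ j := fun h => hj (h ▸ hi)
  have h1 := cechSign_mul_cechSign_erase (Finset.mem_insert_of_mem hi) (Finset.mem_insert_self j τ)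
    hij
  have h2 : cechSign (insert j τ) j = cechSign τ j := by
    rw [← cechSign_erase_self (insert j τ), Finset.erase_insert hj]
  have h3 : cechSign ((insert j τ).erase i) j = cechSign (τ.erase i) j := by
    rw [← cechSign_erase_self ((insert j τ).erase i), Finset.erase_right_comm,
      Finset.erase_insert hj]
  rw [h2, h3, Finset.erase_insert hj] at h1
  have ha := cechSign_mul_self τ j
  have he := cechSign_mul_self (τ.erase i) j
  -- Signs square to one, so multiplying `h1` by the two signs at `j` moves them to the other side.
  linear_combination (cechSign τ j * cechSign (τ.erase i) j) * h1 -
    (cechSign τ i * cechSign (τ.erase i) j) * ha - cechSign (insert j τ) i * cechSign τ j * he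

/-- The Čech differential on families indexed by all subsets of the variables, with values in one
abelian group. -/
def altSum {A : Type*} [AddCommGroup A] (f : Finset (Fin d) → A) (τ : Finset (Fin d)) : A :=
  ∑ i ∈ τ, cechSign τ i • f (τ.erase i)

theorem altSum_congr {A : Type*} [AddCommGroup A] {f g : Finset (Fin d) → A} {τ : Finset (Fin d)}
    (h : ∀ i ∈ τ, f (τ.erase i) = g (τ.erase i)) : altSum f τ = altSum g τ :=
  Finset.sum_congr rfl fun i hi => by rw [h i hi]

/-- The double sum runs over ordered pairs of removed elements, and exchanging the two reverses the
sign. -/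
theorem altSum_altSum {A : Type*} [AddCommGroup A] (f : Finset (Fin d) → A) (τ : Finset (Fin d)) :
    altSum (altSum f) τ = 0 := by
  have h : altSum (altSum f) τ = ∑ x ∈ τ.sigma fun i => τ.erase i,
      (cechSign τ x.1 * cechSign (τ.erase x.1) x.2) • f ((τ.erase x.1).erase x.2) := by
    rw [Finset.sum_sigma]
    refine Finset.sum_congr rfl fun i _ => ?_
    rw [altSum, Finset.smul_sum]
    exact Finset.sum_congr rfl fun k _ => by rw [mul_smul]
  rw [h]
  refine Finset.sum_involution (fun x _ => ⟨x.2, x.1⟩) ?_ ?_ ?_ ?_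
  · rintro ⟨i, k⟩ hx
    simp only [Finset.mem_sigma, Finset.mem_erase] at hx
    rw [cechSign_mul_cechSign_erase hx.1 hx.2.2 hx.2.1.symm, Finset.erase_right_comm (a := i),
      neg_smul, neg_add_cancel]
  · rintro ⟨i, k⟩ hx _ h
    simp only [Finset.mem_sigma, Finset.mem_erase] at hx
    exact hx.2.1 (by simpa using congrArg Sigma.fst h)
  · rintro ⟨i, k⟩ hx
    simp only [Finset.mem_sigma, Finset.mem_erase] at hx ⊢
    exact ⟨hx.2.2, hx.2.1.symm, hx.1⟩
  · rintro ⟨i, k⟩ _; rfl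

end Sign

/-! ### Functoriality and graded exactness of the Čech complex -/

section Cech

variable {K : Type*} [Field K] {d : ℕ}
  {M N P : Type*} [AddCommGroup M] [Module (MvPolynomial (Fin d) K) M]
  [AddCommGroup N] [Module (MvPolynomial (Fin d) K) N]
  [AddCommGroup P] [Module (MvPolynomial (Fin d) K) P]

theorem liftOfLE_mk {σ τ : Finset (Fin d)} (h : monomialsOn K σ ≤ monomialsOn K τ) (m : M)
    (s : monomialsOn K σ) :
    LocalizedModule.liftOfLE (monomialsOn K σ) (monomialsOn K τ) h
      (LocalizedModule.mk m s) = LocalizedModule.mk m ⟨s.1, h s.2⟩ := by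
  rw [IsLocalizedModule.mk_eq_mk', IsLocalizedModule.mk_eq_mk', LocalizedModule.liftOfLE,
    IsLocalizedModule.liftOfLE_mk']

/-- A Čech cochain as a family indexed by all subsets, after applying additive maps `E`. -/
def cochainFamily {A : Type*} [AddCommGroup A]
    (E : ∀ σ : Finset (Fin d), LocalizedModule (monomialsOn K σ) M →+ A) {p : ℕ}
    (x : CechCochain K d M p) (σ : Finset (Fin d)) : A :=
  if h : σ.card = p then E σ (x ⟨σ, h⟩) else 0

theorem cochainFamily_of_card {A : Type*} [AddCommGroup A]
    (E : ∀ σ : Finset (Fin d), LocalizedModule (monomialsOn K σ) M →+ A) {p : ℕ}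
    (x : CechCochain K d M p) {σ : Finset (Fin d)} (h : σ.card = p) :
    cochainFamily E x σ = E σ (x ⟨σ, h⟩) := dif_pos h

theorem cochainFamily_of_card_ne {A : Type*} [AddCommGroup A]
    (E : ∀ σ : Finset (Fin d), LocalizedModule (monomialsOn K σ) M →+ A) {p : ℕ}
    (x : CechCochain K d M p) {σ : Finset (Fin d)} (h : σ.card ≠ p) :
    cochainFamily E x σ = 0 := dif_neg h

theorem cechD_apply {p : ℕ} (x : CechCochain K d M p) (τ : {τ : Finset (Fin d) // τ.card = p + 1}) :
    cechD K d M p x τ = ∑ i : {i // i ∈ τ.1}, cechSign τ.1 i.1 •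
      LocalizedModule.liftOfLE (monomialsOn K (τ.1.erase i.1)) (monomialsOn K τ.1)
        (monomialsOn_mono K (Finset.erase_subset i.1 τ.1))
        (x ⟨τ.1.erase i.1, by rw [Finset.card_erase_of_mem i.2, τ.2, Nat.add_sub_cancel]⟩) := by
  simp only [cechD, LinearMap.pi_apply, LinearMap.sum_apply, LinearMap.smul_apply,
    LinearMap.comp_apply, LinearMap.proj_apply]
  refine Finset.sum_congr rfl fun i _ => ?_
  rw [cechSign, ← Int.cast_smul_eq_zsmul (MvPolynomial (Fin d) K)]
  push_cast
  rfl

/-- Maps `E` that respect restriction put all localizations into one group, where the differential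
becomes `altSum` and no dependent types remain. Compatibility is required only below `τ₀`, so that
the target may itself be a localization, as in `cechD_cechD`. -/
theorem map_cechD_apply {A : Type*} [AddCommGroup A] {τ₀ : Finset (Fin d)}
    (E : ∀ σ : Finset (Fin d), LocalizedModule (monomialsOn K σ) M →+ A)
    (hE : ∀ (σ τ : Finset (Fin d)) (h : σ ⊆ τ), τ ⊆ τ₀ → ∀ x, E τ (LocalizedModule.liftOfLE
      (monomialsOn K σ) (monomialsOn K τ) (monomialsOn_mono K h) x) = E σ x)
    {p : ℕ} (x : CechCochain K d M p) {τ : Finset (Fin d)} (hτ : τ.card = p + 1) (hτ₀ : τ ⊆ τ₀) :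
    E τ (cechD K d M p x ⟨τ, hτ⟩) = altSum (cochainFamily E x) τ := by
  rw [cechD_apply, map_sum, altSum, ← Finset.sum_coe_sort τ]
  refine Finset.sum_congr rfl fun i _ => ?_
  rw [map_zsmul, hE _ _ (Finset.erase_subset _ _) hτ₀, cochainFamily_of_card]

theorem cechD_cechD {p : ℕ} (x : CechCochain K d M p) :
    cechD K d M (p + 1) (cechD K d M p x) = 0 := by
  funext τ
  obtain ⟨τ, hτ⟩ := τ
  -- All terms that contribute to the component at `τ` are compared inside the localization at
  -- `X_τ`; the value zero for the other `σ` is never reached.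
  let E : ∀ σ : Finset (Fin d), LocalizedModule (monomialsOn K σ) M →+
      LocalizedModule (monomialsOn K τ) M := fun σ =>
    if h : σ ⊆ τ then (LocalizedModule.liftOfLE (monomialsOn K σ) (monomialsOn K τ)
      (monomialsOn_mono K h)).toAddMonoidHom else 0
  have hE : ∀ (σ ρ : Finset (Fin d)) (h : σ ⊆ ρ), ρ ⊆ τ → ∀ x, E ρ (LocalizedModule.liftOfLE
      (monomialsOn K σ) (monomialsOn K ρ) (monomialsOn_mono K h) x) = E σ x := by
    intro σ ρ h hρ x
    induction x using LocalizedModule.induction_on with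
    | h m s =>
      rw [liftOfLE_mk]
      simp only [E, dif_pos hρ, dif_pos (h.trans hρ), LinearMap.toAddMonoidHom_coe]
      rw [liftOfLE_mk, liftOfLE_mk]
  have hid : ∀ y, E τ y = y := by
    intro y
    induction y using LocalizedModule.induction_on with
    | h m s =>
      simp only [E, dif_pos (Finset.Subset.refl τ), LinearMap.toAddMonoidHom_coe]
      rw [liftOfLE_mk]
  rw [← hid (cechD K d M (p + 1) (cechD K d M p x) ⟨τ, hτ⟩), map_cechD_apply E hE _ hτ subset_rfl,
    altSum_congr (g := altSum (cochainFamily E x)), altSum_altSum]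
  · rfl
  · intro i hi
    have hc : (τ.erase i).card = p + 1 := by
      rw [Finset.card_erase_of_mem hi, hτ, Nat.add_sub_cancel]
    rw [cochainFamily_of_card _ _ hc, map_cechD_apply E hE _ hc (Finset.erase_subset i τ)]

/-- The map induced on the `X_σ`-localizations. -/
def locMap (σ : Finset (Fin d)) (φ : M →ₗ[MvPolynomial (Fin d) K] N) :
    LocalizedModule (monomialsOn K σ) M →ₗ[MvPolynomial (Fin d) K]
      LocalizedModule (monomialsOn K σ) N :=
  IsLocalizedModule.map (monomialsOn K σ) (LocalizedModule.mkLinearMap (monomialsOn K σ) M)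
    (LocalizedModule.mkLinearMap (monomialsOn K σ) N) φ

theorem locMap_mk (σ : Finset (Fin d)) (φ : M →ₗ[MvPolynomial (Fin d) K] N) (m : M)
    (s : monomialsOn K σ) :
    locMap σ φ (LocalizedModule.mk m s) = LocalizedModule.mk (φ m) s :=
  IsLocalizedModule.map_LocalizedModules (monomialsOn K σ) φ m s

/-- The map induced on Čech cochains. -/
def cechMap (φ : M →ₗ[MvPolynomial (Fin d) K] N) (p : ℕ) :
    CechCochain K d M p →ₗ[MvPolynomial (Fin d) K] CechCochain K d N p :=
  LinearMap.pi fun σ => (locMap σ.1 φ).comp (LinearMap.proj σ)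

theorem cechMap_apply (φ : M →ₗ[MvPolynomial (Fin d) K] N) {p : ℕ} (x : CechCochain K d M p)
    (σ : {σ : Finset (Fin d) // σ.card = p}) : cechMap φ p x σ = locMap σ.1 φ (x σ) := rfl

theorem cechMap_cechD (φ : M →ₗ[MvPolynomial (Fin d) K] N) {p : ℕ} (x : CechCochain K d M p) :
    cechMap φ (p + 1) (cechD K d M p x) = cechD K d N p (cechMap φ p x) := by
  funext τ
  rw [cechMap_apply, cechD_apply, cechD_apply, map_sum]
  refine Finset.sum_congr rfl fun i _ => ?_
  rw [map_zsmul, cechMap_apply]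
  congr 1
  generalize x _ = y
  induction y using LocalizedModule.induction_on with
  | h m s => rw [liftOfLE_mk, locMap_mk, locMap_mk, liftOfLE_mk]

theorem cechMap_comp_eq_zero {φ : M →ₗ[MvPolynomial (Fin d) K] N}
    {ψ : N →ₗ[MvPolynomial (Fin d) K] P} (h : ∀ m, ψ (φ m) = 0) {p : ℕ}
    (x : CechCochain K d M p) : cechMap ψ p (cechMap φ p x) = 0 := by
  funext σ
  rw [cechMap_apply, cechMap_apply]
  generalize x σ = y
  induction y using LocalizedModule.induction_on with
  | h m s => rw [locMap_mk, locMap_mk, h, LocalizedModule.zero_mk]; rfl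

theorem cechMap_injective {φ : M →ₗ[MvPolynomial (Fin d) K] N} (h : Function.Injective φ) (p : ℕ) :
    Function.Injective (cechMap φ p) := by
  intro x y hxy
  funext σ
  exact IsLocalizedModule.map_injective (monomialsOn K σ.1) _ _ φ h (congrFun hxy σ)

variable (K d) in
/-- Multiplication by a monomial in the `X_i` raises the degree by the degree of the monomial. -/
def IsMonomialGraded (𝓜 : ℤ → AddSubgroup M) : Prop :=
  ∀ (u : Fin d →₀ ℕ) (a : ℤ), ∀ m ∈ 𝓜 a, monomial u (1 : K) • m ∈ 𝓜 (a + (u.degree : ℤ))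

variable {𝓜 : ℤ → AddSubgroup M} {𝓝 : ℤ → AddSubgroup N} {𝓟 : ℤ → AddSubgroup P}

theorem mk_mem_locComponent {σ : Finset (Fin d)} {μ : ℤ} {u : Fin d →₀ ℕ} (hu : u.support ⊆ σ)
    {m : M} (hm : m ∈ 𝓜 (μ + (u.degree : ℤ))) :
    LocalizedModule.mk m (⟨monomial u 1, u, hu, rfl⟩ : monomialsOn K σ) ∈
      locComponent K d 𝓜 σ μ := by
  refine AddSubgroup.mem_iSup_of_mem u (AddSubgroup.mem_iSup_of_mem hu ⟨m, hm, ?_⟩)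
  change LocalizedModule.divBy _ (LocalizedModule.mk m 1) = _
  rw [LocalizedModule.divBy_apply, LocalizedModule.liftOn_mk]
  exact congrArg (LocalizedModule.mk m) (one_mul _)

/-- Fractions in the supremum can be brought to a common monomial denominator, and monomials shift
degrees correctly, so a single fraction suffices. -/
theorem mem_locComponent_iff (h𝓜 : IsMonomialGraded K d 𝓜) {σ : Finset (Fin d)} {μ : ℤ}
    {x : LocalizedModule (monomialsOn K σ) M} :
    x ∈ locComponent K d 𝓜 σ μ ↔ ∃ (u : Fin d →₀ ℕ) (hu : u.support ⊆ σ),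
      ∃ m ∈ 𝓜 (μ + (u.degree : ℤ)),
        LocalizedModule.mk m (⟨monomial u 1, u, hu, rfl⟩ : monomialsOn K σ) = x := by
  refine ⟨fun hx => ?_, ?_⟩
  · have hadd : ∀ x y : LocalizedModule (monomialsOn K σ) M,
        (∃ (u : Fin d →₀ ℕ) (hu : u.support ⊆ σ), ∃ m ∈ 𝓜 (μ + (u.degree : ℤ)),
          LocalizedModule.mk m (⟨monomial u 1, u, hu, rfl⟩ : monomialsOn K σ) = x) →
        (∃ (u : Fin d →₀ ℕ) (hu : u.support ⊆ σ), ∃ m ∈ 𝓜 (μ + (u.degree : ℤ)),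
          LocalizedModule.mk m (⟨monomial u 1, u, hu, rfl⟩ : monomialsOn K σ) = y) →
        ∃ (u : Fin d →₀ ℕ) (hu : u.support ⊆ σ), ∃ m ∈ 𝓜 (μ + (u.degree : ℤ)),
          LocalizedModule.mk m (⟨monomial u 1, u, hu, rfl⟩ : monomialsOn K σ) = x + y := by
      rintro _ _ ⟨u, hu, m, hm, rfl⟩ ⟨v, hv, n, hn, rfl⟩
      refine ⟨u + v, Finsupp.support_add.trans (Finset.union_subset hu hv),
        monomial v (1 : K) • m + monomial u (1 : K) • n, add_mem ?_ ?_, ?_⟩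
      · have := h𝓜 v _ m hm
        rwa [add_assoc, ← Nat.cast_add, ← map_add] at this
      · have := h𝓜 u _ n hn
        rwa [add_assoc, ← Nat.cast_add, ← map_add, add_comm v u] at this
      · rw [LocalizedModule.mk_add_mk]
        congr 1
        exact Subtype.ext (by simp [monomial_mul])
    induction hx using AddSubgroup.iSup_induction' with
    | hp u x hx =>
      induction hx using AddSubgroup.iSup_induction' with
      | hp hu x hx =>
        obtain ⟨m, hm, rfl⟩ := hx
        refine ⟨u, hu, m, hm, ?_⟩
        change _ = LocalizedModule.divBy _ (LocalizedModule.mk m 1)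
        rw [LocalizedModule.divBy_apply, LocalizedModule.liftOn_mk]
        exact congrArg (LocalizedModule.mk m) (one_mul _).symm
      | h1 => exact ⟨0, by simp, 0, zero_mem _, LocalizedModule.zero_mk _⟩
      | hadd x y _ _ hx hy => exact hadd x y hx hy
    | h1 => exact ⟨0, by simp, 0, zero_mem _, LocalizedModule.zero_mk _⟩
    | hadd x y _ _ hx hy => exact hadd x y hx hy
  · rintro ⟨u, hu, m, hm, rfl⟩
    exact mk_mem_locComponent hu hm

theorem mem_cechComponent {p : ℕ} {μ : ℤ} {x : CechCochain K d M p} :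
    x ∈ cechComponent K d 𝓜 p μ ↔ ∀ σ, x σ ∈ locComponent K d 𝓜 σ.1 μ := by
  simp [cechComponent, AddSubgroup.mem_pi]

theorem cechD_mem (h𝓜 : IsMonomialGraded K d 𝓜) {p : ℕ} {μ : ℤ} {x : CechCochain K d M p}
    (hx : x ∈ cechComponent K d 𝓜 p μ) : cechD K d M p x ∈ cechComponent K d 𝓜 (p + 1) μ := by
  rw [mem_cechComponent] at hx ⊢
  intro τ
  rw [cechD_apply]
  refine sum_mem fun i _ => zsmul_mem ?_ _
  obtain ⟨u, hu, m, hm, h⟩ := (mem_locComponent_iff h𝓜).1 (hx ⟨τ.1.erase i.1, by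
    rw [Finset.card_erase_of_mem i.2, τ.2, Nat.add_sub_cancel]⟩)
  rw [← h, liftOfLE_mk]
  exact mk_mem_locComponent (hu.trans (Finset.erase_subset _ _)) hm

theorem cechMap_mem (h𝓜 : IsMonomialGraded K d 𝓜) {φ : M →ₗ[MvPolynomial (Fin d) K] N}
    (hφ : ∀ a, ∀ m ∈ 𝓜 a, φ m ∈ 𝓝 a) {p : ℕ} {μ : ℤ} {x : CechCochain K d M p}
    (hx : x ∈ cechComponent K d 𝓜 p μ) : cechMap φ p x ∈ cechComponent K d 𝓝 p μ := by
  rw [mem_cechComponent] at hx ⊢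
  intro σ
  obtain ⟨u, hu, m, hm, h⟩ := (mem_locComponent_iff h𝓜).1 (hx σ)
  rw [cechMap_apply, ← h, locMap_mk]
  exact mk_mem_locComponent hu (hφ _ m hm)

theorem exists_cechMap_eq_of_surjective (h𝓝 : IsMonomialGraded K d 𝓝)
    {φ : M →ₗ[MvPolynomial (Fin d) K] N}
    (hφ : ∀ a, ∀ n ∈ 𝓝 a, ∃ m ∈ 𝓜 a, φ m = n) {p : ℕ} {μ : ℤ} {x : CechCochain K d N p}
    (hx : x ∈ cechComponent K d 𝓝 p μ) : ∃ y ∈ cechComponent K d 𝓜 p μ, cechMap φ p y = x := by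
  rw [mem_cechComponent] at hx
  have : ∀ σ : {σ : Finset (Fin d) // σ.card = p},
      ∃ y ∈ locComponent K d 𝓜 σ.1 μ, locMap σ.1 φ y = x σ := by
    intro σ
    obtain ⟨u, hu, n, hn, h⟩ := (mem_locComponent_iff h𝓝).1 (hx σ)
    obtain ⟨m, hm, rfl⟩ := hφ _ n hn
    exact ⟨_, mk_mem_locComponent hu hm, by rw [locMap_mk, h]⟩
  choose y hy hyx using this
  exact ⟨y, mem_cechComponent.2 hy, funext hyx⟩

/-- Exactness of localization, degree by degree: if `ψ n / X^u` is zero, some `X^v` kills `ψ n`, so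
`X^v n` has a homogeneous preimage, which is then divided by `X^(u+v)`. -/
theorem exists_cechMap_eq_of_exact (h𝓝 : IsMonomialGraded K d 𝓝)
    {φ : M →ₗ[MvPolynomial (Fin d) K] N} {ψ : N →ₗ[MvPolynomial (Fin d) K] P}
    (hφ : ∀ a, ∀ n ∈ 𝓝 a, ψ n = 0 → ∃ m ∈ 𝓜 a, φ m = n) {p : ℕ} {μ : ℤ}
    {x : CechCochain K d N p} (hx : x ∈ cechComponent K d 𝓝 p μ) (hψ : cechMap ψ p x = 0) :
    ∃ y ∈ cechComponent K d 𝓜 p μ, cechMap φ p y = x := by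
  rw [mem_cechComponent] at hx
  have : ∀ σ : {σ : Finset (Fin d) // σ.card = p},
      ∃ y ∈ locComponent K d 𝓜 σ.1 μ, locMap σ.1 φ y = x σ := by
    intro σ
    obtain ⟨u, hu, n, hn, h⟩ := (mem_locComponent_iff h𝓝).1 (hx σ)
    have h0 : locMap σ.1 ψ (x σ) = 0 := congrFun hψ σ
    rw [← h, locMap_mk, IsLocalizedModule.mk_eq_mk', IsLocalizedModule.mk'_eq_zero'] at h0
    obtain ⟨⟨_, v, hv, rfl⟩, h0⟩ := h0
    rw [Submonoid.smul_def, ← map_smul] at h0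
    obtain ⟨m, hm, hmn⟩ := hφ _ _ (h𝓝 v _ n hn) h0
    rw [add_assoc, ← Nat.cast_add, ← map_add] at hm
    refine ⟨_, mk_mem_locComponent (K := K)
      (Finsupp.support_add.trans (Finset.union_subset hu hv)) hm, ?_⟩
    rw [locMap_mk, hmn, ← h, ← LocalizedModule.mk_cancel_common_right
      (⟨monomial u 1, u, hu, rfl⟩ : monomialsOn K σ.1) ⟨monomial v 1, v, hv, rfl⟩]
    congr 1
    exact Subtype.ext (by simp [monomial_mul])
  choose y hy hyx using this
  exact ⟨y, mem_cechComponent.2 hy, funext hyx⟩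

variable (K d 𝓜) in
/-- The coboundaries of cochains of degree `μ`. -/
def gradedCoboundary (μ : ℤ) : (p : ℕ) → AddSubgroup (CechCochain K d M p)
  | 0 => ⊥
  | p + 1 => (cechComponent K d 𝓜 p μ).map (cechD K d M p).toAddMonoidHom

theorem cechMap_mem_gradedCoboundary (h𝓜 : IsMonomialGraded K d 𝓜)
    {φ : M →ₗ[MvPolynomial (Fin d) K] N} (hφ : ∀ a, ∀ m ∈ 𝓜 a, φ m ∈ 𝓝 a) {p : ℕ} {μ : ℤ}
    {x : CechCochain K d M p} (hx : x ∈ gradedCoboundary K d 𝓜 μ p) :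
    cechMap φ p x ∈ gradedCoboundary K d 𝓝 μ p := by
  cases p with
  | zero => rw [AddSubgroup.mem_bot.1 hx, map_zero]; exact zero_mem _
  | succ p =>
    obtain ⟨y, hy, rfl⟩ := hx
    exact ⟨_, cechMap_mem h𝓜 hφ hy, (cechMap_cechD φ y).symm⟩

variable (K d 𝓜) in
/-- Every cocycle of degree `μ` in the `p`-th term of the Čech complex is the coboundary of a
cochain of degree `μ`. -/
def CechAcyclic (p : ℕ) (μ : ℤ) : Prop :=
  ∀ x ∈ cechComponent K d 𝓜 p μ, cechD K d M p x = 0 → x ∈ gradedCoboundary K d 𝓜 μ p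

theorem CechAcyclic.localCohomologyComponent_eq_bot {p : ℕ} {μ : ℤ}
    (h : CechAcyclic K d 𝓜 p μ) : localCohomologyComponent K d 𝓜 p μ = ⊥ := by
  rw [eq_bot_iff]
  rintro _ ⟨x, hx, rfl⟩
  refine (Submodule.Quotient.mk_eq_zero _).2 ?_
  have hx' := h x.1 hx x.2
  change x.1 ∈ cechB K d M p
  cases p with
  | zero => rw [AddSubgroup.mem_bot.1 hx']; exact zero_mem _
  | succ p => obtain ⟨y, _, hy⟩ := hx'; exact ⟨y, hy⟩

/-- Acyclicity descends along an injective map that is onto in each degree. -/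
theorem CechAcyclic.of_injective (h𝓜 : IsMonomialGraded K d 𝓜) (h𝓝 : IsMonomialGraded K d 𝓝)
    {φ : M →ₗ[MvPolynomial (Fin d) K] N}
    (hinj : Function.Injective φ) (hφ : ∀ a, ∀ m ∈ 𝓜 a, φ m ∈ 𝓝 a)
    (hsurj : ∀ a, ∀ n ∈ 𝓝 a, ∃ m ∈ 𝓜 a, φ m = n) {p : ℕ} {μ : ℤ}
    (h : CechAcyclic K d 𝓝 p μ) : CechAcyclic K d 𝓜 p μ := by
  intro x hx hdx
  have h1 := h _ (cechMap_mem h𝓜 hφ hx) (by rw [← cechMap_cechD, hdx, map_zero])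
  cases p with
  | zero => exact cechMap_injective hinj 0 ((AddSubgroup.mem_bot.1 h1).trans (map_zero _).symm)
  | succ p =>
    obtain ⟨y, hy, hyx⟩ := h1
    -- The map is onto only on graded pieces, which is why acyclicity asks for a primitive of the
    -- same degree.
    obtain ⟨z, hz, rfl⟩ := exists_cechMap_eq_of_surjective h𝓝 hsurj hy
    refine ⟨z, hz, cechMap_injective hinj (p + 1) ?_⟩
    rw [← hyx]
    exact cechMap_cechD φ z

/-- One step of the descending induction along a resolution `M → N → P`. -/
theorem cech_decomposition_step (h𝓜 : IsMonomialGraded K d 𝓜) (h𝓝 : IsMonomialGraded K d 𝓝)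
    {φ : M →ₗ[MvPolynomial (Fin d) K] N} {ψ : N →ₗ[MvPolynomial (Fin d) K] P}
    (hφ : ∀ a, ∀ m ∈ 𝓜 a, φ m ∈ 𝓝 a)
    (hexact : ∀ a, ∀ n ∈ 𝓝 a, ψ n = 0 → ∃ m ∈ 𝓜 a, φ m = n) {p : ℕ} {μ : ℤ}
    (hN : CechAcyclic K d 𝓝 p μ)
    (hM : ∀ w ∈ cechComponent K d 𝓜 (p + 1) μ, cechMap φ (p + 2) (cechD K d M (p + 1) w) = 0 →
      ∃ b ∈ gradedCoboundary K d 𝓜 μ (p + 1), cechMap φ (p + 1) w = cechMap φ (p + 1) b)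
    {x : CechCochain K d N p} (hx : x ∈ cechComponent K d 𝓝 p μ)
    (hψ : cechMap ψ (p + 1) (cechD K d N p x) = 0) :
    ∃ b ∈ gradedCoboundary K d 𝓝 μ p, ∃ z ∈ cechComponent K d 𝓜 p μ,
      x = b + cechMap φ p z := by
  obtain ⟨w, hw, hwx⟩ := exists_cechMap_eq_of_exact h𝓝 hexact (cechD_mem h𝓝 hx) hψ
  -- `hM` expresses the vanishing of `H^{p+1}` of the image of `φ` in degree `μ` without naming that
  -- module. It gives `d x = φ(d y) = d(φ y)`, so `x - φ y` is a cocycle and `hN` applies.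
  obtain ⟨_, ⟨y, hy, rfl⟩, hwy⟩ := hM w hw (by rw [cechMap_cechD, hwx, cechD_cechD])
  refine ⟨x - cechMap φ p y, hN _ (sub_mem hx (cechMap_mem h𝓜 hφ hy)) ?_, y, hy,
    (sub_add_cancel _ _).symm⟩
  rw [map_sub, ← hwx, hwy, sub_eq_zero]
  exact cechMap_cechD φ y

end Cech

/-! ### Contraction onto a vertex -/

section Cone

variable {d : ℕ} {A B : Type*} [AddCommGroup A] [AddCommGroup B]

theorem map_altSum (E : A →+ B) (f : Finset (Fin d) → A) (τ : Finset (Fin d)) :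
    E (altSum f τ) = altSum (fun σ => E (f σ)) τ := by
  simp [altSum, map_sum, map_zsmul]

/-- The contraction of the full simplex onto the vertex `j`. -/
def cone (j : Fin d) (f : Finset (Fin d) → A) (σ : Finset (Fin d)) : A :=
  if j ∈ σ then 0 else cechSign σ j • f (insert j σ)

/-- If `j ∈ τ`, only the term that removes `j` survives. If `j ∉ τ`, the cocycle condition at
`insert j τ` expresses `f τ` through the remaining terms. -/
theorem altSum_cone (j : Fin d) (f : Finset (Fin d) → A) (τ : Finset (Fin d))
    (h : j ∉ τ → altSum f (insert j τ) = 0) : altSum (cone j f) τ = f τ := by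
  by_cases hj : j ∈ τ
  · rw [altSum, Finset.sum_eq_single_of_mem j hj]
    · rw [cone, if_neg (Finset.notMem_erase j τ), smul_smul, cechSign_erase_self,
        cechSign_mul_self, one_smul, Finset.insert_erase hj]
    · intro i _ hij
      rw [cone, if_pos (Finset.mem_erase.2 ⟨hij.symm, hj⟩), smul_zero]
  · have h1 := h hj
    rw [altSum, Finset.sum_insert hj, Finset.erase_insert hj, ← cechSign_erase_self (insert j τ),
      Finset.erase_insert hj] at h1
    have h2 : altSum (cone j f) τ =
        -(cechSign τ j • ∑ i ∈ τ, cechSign (insert j τ) i • f ((insert j τ).erase i)) := by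
      rw [altSum, Finset.smul_sum, ← Finset.sum_neg_distrib]
      refine Finset.sum_congr rfl fun i hi => ?_
      have hij : i ≠ j := fun h => hj (h ▸ hi)
      rw [cone, if_neg fun h => hj (Finset.mem_of_mem_erase h), smul_smul, smul_smul,
        cechSign_mul_cechSign_of_notMem hi hj, neg_smul, mul_comm,
        Finset.erase_insert_of_ne hij.symm]
    rw [h2, ← neg_eq_of_add_eq_zero_right h1, smul_neg, neg_neg, smul_smul, cechSign_mul_self,
      one_smul]

end Cone

/-! ### Restriction of scalars to `Q` -/

section OverX

variable {K : Type*} [Field K] {d b c : ℕ}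

/-- An `S`-module, regarded as a module over `Q = K[X_1, …, X_d]`. -/
def OverX (K : Type*) [Field K] (d b c : ℕ) (M : Type*) [AddCommGroup M]
    [Module (TriPoly K d b c) M] : Type _ := M

variable {M N : Type*} [AddCommGroup M] [Module (TriPoly K d b c) M] [AddCommGroup N]
  [Module (TriPoly K d b c) N]

instance : AddCommGroup (OverX K d b c M) := inferInstanceAs (AddCommGroup M)

instance : Module (MvPolynomial (Fin d) K) (OverX K d b c M) :=
  Module.compHom M (inclX K d b c)

/-- An `S`-linear map is `Q`-linear. -/
def overXMap (φ : M →ₗ[TriPoly K d b c] N) :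
    OverX K d b c M →ₗ[MvPolynomial (Fin d) K] OverX K d b c N where
  toFun := φ
  map_add' := φ.map_add
  map_smul' q m := φ.map_smul (inclX K d b c q) m

theorem inclX_monomial (u : Fin d →₀ ℕ) :
    inclX K d b c (monomial u 1) = monomial (u.mapDomain Sum.inl) 1 := by
  change rename Sum.inl _ = _
  rw [rename_monomial]

theorem weight_triDegree_mapDomain (h : Fin b → ℤ) (g : Fin c → ℤ) (u : Fin d →₀ ℕ) :
    Finsupp.weight (triDegree d h g) (u.mapDomain Sum.inl) = (0, 0, (u.degree : ℤ)) := by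
  rw [Finsupp.weight_apply, Finsupp.sum_mapDomain_index (by simp) (by intros; rw [add_smul]),
    Finsupp.degree_apply, Finsupp.sum]
  simp only [triDegree, Prod.smul_mk, smul_zero, nsmul_eq_mul, mul_one]
  induction u.support using Finset.induction_on with
  | empty => simp; rfl
  | insert i s hi ih => rw [Finset.sum_insert hi, Finset.sum_insert hi, ih]; simp

theorem inclX_monomial_mem (h : Fin b → ℤ) (g : Fin c → ℤ) (u : Fin d →₀ ℕ) :
    inclX K d b c (monomial u 1) ∈ triGrading K d h g (0, 0, (u.degree : ℤ)) := by
  rw [inclX_monomial]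
  exact isWeightedHomogeneous_monomial _ _ _ (weight_triDegree_mapDomain h g u)

variable (K d b c) in
/-- The strand `⨁_a M_{(i,n,a)}` as a family of subgroups of the `Q`-module `M`. -/
def overXGrading (𝓜 : ℤ × ℤ × ℤ → AddSubgroup M) (i n a : ℤ) : AddSubgroup (OverX K d b c M) :=
  𝓜 (i, n, a)

theorem mem_overXGrading {𝓜 : ℤ × ℤ × ℤ → AddSubgroup M} {i n a : ℤ} {m : M} :
    (m : OverX K d b c M) ∈ overXGrading K d b c 𝓜 i n a ↔ m ∈ 𝓜 (i, n, a) := Iff.rfl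

theorem isMonomialGraded_overXGrading (h : Fin b → ℤ) (g : Fin c → ℤ)
    (𝓜 : ℤ × ℤ × ℤ → AddSubgroup M) [SetLike.GradedSMul (triGrading K d h g) 𝓜] (i n : ℤ) :
    IsMonomialGraded K d (overXGrading K d b c 𝓜 i n) := by
  intro u a m hm
  have : inclX K d b c (monomial u 1) • (show M from m) ∈
      𝓜 (((0, 0, (u.degree : ℤ)) : ℤ × ℤ × ℤ) +ᵥ (i, n, a)) :=
    SetLike.GradedSMul.smul_mem (A := triGrading K d h g) (inclX_monomial_mem (K := K) h g u)
      (mem_overXGrading.1 hm)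
  simp only [vadd_eq_add, Prod.mk_add_mk, zero_add] at this
  rwa [add_comm] at this

end OverX

/-! ### Embedding the localized free modules into Laurent polynomials -/

section Laurent

variable (K : Type*) [Field K] (d b c : ℕ)

/-- Laurent polynomials in all the variables. -/
abbrev Laurent : Type _ := AddMonoidAlgebra K (Fin d ⊕ Fin b ⊕ Fin c →₀ ℤ)

variable {d b c} in
/-- Natural exponents as integral exponents. -/
def intExp : (Fin d ⊕ Fin b ⊕ Fin c →₀ ℕ) →+ (Fin d ⊕ Fin b ⊕ Fin c →₀ ℤ) :=
  Finsupp.mapRange.addMonoidHom (Nat.castAddMonoidHom ℤ)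

variable {d b c} in
theorem intExp_apply (u : Fin d ⊕ Fin b ⊕ Fin c →₀ ℕ) (v) : intExp u v = (u v : ℤ) := rfl

variable {d b c} in
theorem intExp_injective : Function.Injective (intExp (d := d) (b := b) (c := c)) := by
  intro u v h
  ext k
  exact Nat.cast_injective (R := ℤ) (DFunLike.congr_fun h k)

/-- The inclusion of `S` into the Laurent polynomials. -/
def toLaurent : TriPoly K d b c →+* Laurent K d b c :=
  (AddMonoidAlgebra.mapDomainRingHom K intExp :
    AddMonoidAlgebra K (Fin d ⊕ Fin b ⊕ Fin c →₀ ℕ) →+* _)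

variable {K d b c}

theorem toLaurent_monomial (u : Fin d ⊕ Fin b ⊕ Fin c →₀ ℕ) (r : K) :
    toLaurent K d b c (monomial u r) = AddMonoidAlgebra.single (intExp u) r :=
  AddMonoidAlgebra.mapDomain_single

theorem toLaurent_coeff_intExp (f : TriPoly K d b c) (u : Fin d ⊕ Fin b ⊕ Fin c →₀ ℕ) :
    (toLaurent K d b c f).coeff (intExp u) = coeff u f :=
  Finsupp.mapDomain_apply intExp_injective _ _

theorem exists_of_toLaurent_coeff_ne_zero {f : TriPoly K d b c}
    {w : Fin d ⊕ Fin b ⊕ Fin c →₀ ℤ} (hw : (toLaurent K d b c f).coeff w ≠ 0) :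
    ∃ u, intExp u = w ∧ coeff u f ≠ 0 := by
  by_contra! H
  by_cases h : w ∈ Set.range intExp
  · obtain ⟨u, rfl⟩ := h
    exact hw ((toLaurent_coeff_intExp f u).trans (H u rfl))
  · exact hw (Finsupp.mapDomain_of_notMem_range _ _ h)

theorem toLaurent_injective : Function.Injective (toLaurent K d b c) := by
  rw [injective_iff_map_eq_zero]
  intro f hf
  ext u
  rw [← toLaurent_coeff_intExp, hf]; simp

instance : Module (TriPoly K d b c) (Laurent K d b c) :=
  Module.compHom _ (toLaurent K d b c)

variable {r : ℕ}

/-- The vector of Laurent polynomials attached to a vector of polynomials. -/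
def laurentVec (r : ℕ) :
    (Fin r → TriPoly K d b c) →ₗ[TriPoly K d b c] (Fin r → Laurent K d b c) where
  toFun f q := toLaurent K d b c (f q)
  map_add' _ _ := funext fun _ => map_add _ _ _
  map_smul' _ _ := funext fun _ => map_mul _ _ _

/-- The coefficient of the monomial with exponent `w` in the `q`-th coordinate. -/
def laurentCoeff (q : Fin r) (w : Fin d ⊕ Fin b ⊕ Fin c →₀ ℤ) :
    OverX K d b c (Fin r → Laurent K d b c) →+ K where
  toFun x := ((show Fin r → Laurent K d b c from x) q).coeff w
  map_zero' := rfl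
  map_add' _ _ := rfl

theorem laurent_ext {x y : OverX K d b c (Fin r → Laurent K d b c)}
    (h : ∀ q w, laurentCoeff q w x = laurentCoeff q w y) : x = y :=
  funext fun q => AddMonoidAlgebra.coeff_injective (Finsupp.ext fun w => h q w)

theorem laurentCoeff_monomial_smul (u : Fin d →₀ ℕ) (x : OverX K d b c (Fin r → Laurent K d b c))
    (q : Fin r) (w : Fin d ⊕ Fin b ⊕ Fin c →₀ ℤ) :
    laurentCoeff q (w + intExp (u.mapDomain Sum.inl)) (monomial u (1 : K) • x) =
      laurentCoeff q w x := by
  change (toLaurent K d b c (inclX K d b c (monomial u 1)) *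
    (show Fin r → Laurent K d b c from x) q).coeff _ = _
  rw [inclX_monomial, toLaurent_monomial, add_comm]
  exact (AddMonoidAlgebra.coeff_single_mul_add _ _ _ _).trans (one_mul _)

/-- Monomials in the `X_k` are invertible in the Laurent ring; this is what lets every localization
map into the same module. -/
theorem isUnit_monomial (σ : Finset (Fin d)) (s : monomialsOn K σ) :
    IsUnit (algebraMap (MvPolynomial (Fin d) K)
      (Module.End (MvPolynomial (Fin d) K) (OverX K d b c (Fin r → Laurent K d b c))) s) := by
  obtain ⟨_, u, hu, rfl⟩ := s
  rw [Module.End.isUnit_iff]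
  constructor
  · intro x y hxy
    refine laurent_ext fun q w => ?_
    rw [← laurentCoeff_monomial_smul u x, ← laurentCoeff_monomial_smul u y]
    exact congrArg _ hxy
  · intro x
    let x' : Fin r → Laurent K d b c := x
    refine ⟨fun q => AddMonoidAlgebra.single (-intExp (u.mapDomain Sum.inl)) 1 * x' q,
      funext fun q => ?_⟩
    change toLaurent K d b c (inclX K d b c (monomial u 1)) * (_ * x' q) = x' q
    rw [inclX_monomial, toLaurent_monomial, ← mul_assoc, AddMonoidAlgebra.single_mul_single,
      add_neg_cancel, mul_one]
    exact one_mul _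

/-- The embedding of the localizations of a free module into vectors of Laurent polynomials. -/
def locToLaurent (r : ℕ) (σ : Finset (Fin d)) :
    LocalizedModule (monomialsOn K σ) (OverX K d b c (Fin r → TriPoly K d b c))
      →ₗ[MvPolynomial (Fin d) K] OverX K d b c (Fin r → Laurent K d b c) :=
  LocalizedModule.lift (monomialsOn K σ) (overXMap (laurentVec r)) (isUnit_monomial σ)

theorem smul_locToLaurent_mk (σ : Finset (Fin d)) (m : OverX K d b c (Fin r → TriPoly K d b c))
    (s : monomialsOn K σ) :
    s.1 • locToLaurent r σ (LocalizedModule.mk m s) = overXMap (laurentVec r) m := by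
  rw [locToLaurent, LocalizedModule.lift_mk]
  exact ((Module.End.algebraMap_isUnit_inv_apply_eq_iff _ (isUnit_monomial σ s) _ _).1 rfl).symm

theorem laurentCoeff_locToLaurent_mk (σ : Finset (Fin d))
    (m : OverX K d b c (Fin r → TriPoly K d b c)) (u : Fin d →₀ ℕ)
    (hu : monomial u 1 ∈ monomialsOn K σ) (q : Fin r) (w : Fin d ⊕ Fin b ⊕ Fin c →₀ ℤ) :
    laurentCoeff q w (locToLaurent r σ (LocalizedModule.mk m ⟨monomial u 1, hu⟩)) =
      laurentCoeff q (w + intExp (u.mapDomain Sum.inl)) (overXMap (laurentVec r) m) := by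
  rw [← laurentCoeff_monomial_smul u, smul_locToLaurent_mk σ m ⟨monomial u 1, hu⟩]

theorem locToLaurent_liftOfLE {σ τ : Finset (Fin d)} (h : monomialsOn K σ ≤ monomialsOn K τ)
    (x : LocalizedModule (monomialsOn K σ) (OverX K d b c (Fin r → TriPoly K d b c))) :
    locToLaurent r τ (LocalizedModule.liftOfLE (monomialsOn K σ) (monomialsOn K τ) h x) =
      locToLaurent r σ x := by
  induction x using LocalizedModule.induction_on with
  | h m s =>
    rw [liftOfLE_mk]
    obtain ⟨_, u, hu, rfl⟩ := s
    refine laurent_ext fun q w => ?_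
    exact (laurentCoeff_locToLaurent_mk τ m u _ q w).trans
      (laurentCoeff_locToLaurent_mk σ m u _ q w).symm

theorem locToLaurent_injective (σ : Finset (Fin d)) :
    Function.Injective (locToLaurent (K := K) (b := b) (c := c) r σ) := by
  rw [injective_iff_map_eq_zero]
  intro x hx
  induction x using LocalizedModule.induction_on with
  | h m s =>
    have h1 := smul_locToLaurent_mk σ m s
    rw [hx, smul_zero] at h1
    have : m = 0 :=
      funext fun q => toLaurent_injective ((congrFun h1 q).symm.trans (map_zero _).symm)
    rw [this, LocalizedModule.zero_mk]

end Laurent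

/-! ### Acyclicity for graded free modules -/

section FreeAcyclic

variable {K : Type*} [Field K] {d b c r : ℕ} (h : Fin b → ℤ) (g : Fin c → ℤ)
  (t : Fin r → ℤ × ℤ × ℤ)

/-- The components of a graded free module, as subgroups. -/
def freeGrading (K : Type*) [Field K] (d : ℕ) {b c r : ℕ} (h : Fin b → ℤ) (g : Fin c → ℤ)
    (t : Fin r → ℤ × ℤ × ℤ) (ν : ℤ × ℤ × ℤ) :
    AddSubgroup (Fin r → TriPoly K d b c) where
  carrier := freeComponent K d h g t ν
  add_mem' hx hy q := add_mem (hx q) (hy q)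
  zero_mem' _ := zero_mem _
  neg_mem' hx q := neg_mem (hx q)

instance : SetLike.GradedSMul (triGrading K d h g) (freeGrading K d h g t) where
  smul_mem {i j s x} hs hx q := by
    have := IsWeightedHomogeneous.mul hs (hx q)
    rwa [← add_sub_assoc] at this

/-- The exponents of the monomials occurring in the degree `ν` component of the localization at
`X_σ` of the `q`-th summand of a free module. -/
structure IsLocExponent (ν : ℤ × ℤ × ℤ) (σ : Finset (Fin d)) (q : Fin r)
    (w : Fin d ⊕ Fin b ⊕ Fin c →₀ ℤ) : Prop where
  weight : Finsupp.weight (triDegree d h g) w = ν - t q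
  nonneg_inl : ∀ k ∉ σ, 0 ≤ w (.inl k)
  nonneg_inr : ∀ k, 0 ≤ w (.inr k)

theorem weight_intExp (u : Fin d ⊕ Fin b ⊕ Fin c →₀ ℕ) :
    Finsupp.weight (triDegree d h g) (intExp u) = Finsupp.weight (triDegree d h g) u := by
  rw [intExp, Finsupp.weight_apply, Finsupp.weight_apply, Finsupp.mapRange.addMonoidHom_apply,
    Finsupp.sum_mapRange_index (by simp)]
  exact Finsupp.sum_congr fun v _ => natCast_zsmul _ _

theorem intExp_mapDomain_inl (u : Fin d →₀ ℕ) (k : Fin d) :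
    intExp (b := b) (c := c) (u.mapDomain Sum.inl) (.inl k) = u k := by
  rw [intExp_apply, Finsupp.mapDomain_apply Sum.inl_injective]

theorem intExp_mapDomain_inr (u : Fin d →₀ ℕ) (k : Fin b ⊕ Fin c) :
    intExp (u.mapDomain Sum.inl) (.inr k) = 0 := by
  rw [intExp_apply, Finsupp.mapDomain_of_notMem_range _ _ (by simp)]; rfl

variable {h g t} {i n μ : ℤ}

theorem isLocExponent_of_laurentCoeff_ne_zero {σ : Finset (Fin d)}
    {x : LocalizedModule (monomialsOn K σ) (OverX K d b c (Fin r → TriPoly K d b c))}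
    (hx : x ∈ locComponent K d (overXGrading K d b c (freeGrading K d h g t) i n) σ μ)
    {q : Fin r} {w : Fin d ⊕ Fin b ⊕ Fin c →₀ ℤ}
    (hw : laurentCoeff q w (locToLaurent r σ x) ≠ 0) :
    IsLocExponent h g t (i, n, μ) σ q w := by
  obtain ⟨u, hu, m, hm, rfl⟩ :=
    (mem_locComponent_iff (isMonomialGraded_overXGrading h g _ i n)).1 hx
  have e := laurentCoeff_locToLaurent_mk σ m u ⟨u, hu, rfl⟩ q w
  rw [e] at hw
  obtain ⟨v, hv, hvm⟩ := exists_of_toLaurent_coeff_ne_zero hw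
  have hdeg := hm q hvm
  rw [← weight_intExp, hv, map_add, weight_intExp, weight_triDegree_mapDomain] at hdeg
  refine ⟨?_, fun k hk => ?_, fun k => ?_⟩
  · rw [eq_sub_of_add_eq hdeg]
    ext <;> simp; ring
  · have := DFunLike.congr_fun hv (.inl k)
    rw [Finsupp.add_apply, intExp_mapDomain_inl, Finsupp.notMem_support_iff.1 fun h => hk (hu h),
      Nat.cast_zero, add_zero, intExp_apply] at this
    omega
  · have := DFunLike.congr_fun hv (.inr k)
    rw [Finsupp.add_apply, intExp_mapDomain_inr, add_zero, intExp_apply] at this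
    omega

/-- Converse of `isLocExponent_of_laurentCoeff_ne_zero`: the two together describe the image of a
graded piece by its exponents alone. -/
theorem exists_locToLaurent_eq_single {σ : Finset (Fin d)} {q : Fin r}
    {w : Fin d ⊕ Fin b ⊕ Fin c →₀ ℤ} (hw : IsLocExponent h g t (i, n, μ) σ q w) (a : K) :
    ∃ x ∈ locComponent K d (overXGrading K d b c (freeGrading K d h g t) i n) σ μ,
      locToLaurent r σ x =
        (Pi.single q (AddMonoidAlgebra.single w a) : Fin r → Laurent K d b c) := by
  classical
  -- The smallest denominator: it cancels exactly the negative exponents of the `X_k`, all of which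
  -- lie in `σ`.
  let u : Fin d →₀ ℕ := Finsupp.equivFunOnFinite.symm fun k => (-(w (.inl k))).toNat
  have hu : u.support ⊆ σ := fun k hk => by
    by_contra hkσ
    have := hw.nonneg_inl k hkσ
    refine Finsupp.mem_support_iff.1 hk ?_
    change (-(w (.inl k))).toNat = 0
    omega
  let v : Fin d ⊕ Fin b ⊕ Fin c →₀ ℕ := Finsupp.equivFunOnFinite.symm fun k =>
    (w k + intExp (u.mapDomain Sum.inl) k).toNat
  have hv : intExp v = w + intExp (u.mapDomain Sum.inl) := by
    ext k
    rw [intExp_apply, Finsupp.add_apply]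
    refine Int.toNat_of_nonneg ?_
    rcases k with k | k
    · rw [intExp_mapDomain_inl]
      change 0 ≤ w (.inl k) + ((-(w (.inl k))).toNat : ℤ)
      omega
    · rw [intExp_mapDomain_inr, add_zero]; exact hw.nonneg_inr k
  let m : Fin r → TriPoly K d b c := Pi.single q (monomial v a)
  have hm : m ∈ freeGrading K d h g t (i, n, μ + (u.degree : ℤ)) := by
    intro q'
    rcases eq_or_ne q' q with rfl | hq
    · rw [show m q' = monomial v a from Pi.single_eq_same _ _]
      refine isWeightedHomogeneous_monomial _ _ _ ?_
      rw [← weight_intExp, hv, map_add, weight_intExp, weight_triDegree_mapDomain, hw.weight]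
      ext <;> simp; ring
    · rw [show m q' = 0 from Pi.single_eq_of_ne hq _]; exact zero_mem _
  refine ⟨_, mk_mem_locComponent (K := K)
    (𝓜 := overXGrading K d b c (freeGrading K d h g t) i n) hu hm, laurent_ext fun q' w' => ?_⟩
  refine (laurentCoeff_locToLaurent_mk σ m u ⟨u, hu, rfl⟩ q' w').trans ?_
  change (toLaurent K d b c (m q')).coeff _ =
    ((Pi.single q (AddMonoidAlgebra.single w a) : Fin r → Laurent K d b c) q').coeff w'
  rcases eq_or_ne q' q with rfl | hq
  · rw [show m q' = monomial v a from Pi.single_eq_same _ _, Pi.single_eq_same,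
      toLaurent_monomial, hv, AddMonoidAlgebra.coeff_single, AddMonoidAlgebra.coeff_single,
      Finsupp.single_apply, Finsupp.single_apply]
    simp only [add_left_inj]
  · rw [show m q' = 0 from Pi.single_eq_of_ne hq _, Pi.single_eq_of_ne hq, map_zero]; rfl

theorem exists_locToLaurent_eq {σ : Finset (Fin d)}
    (y : OverX K d b c (Fin r → Laurent K d b c))
    (hy : ∀ q w, laurentCoeff q w y ≠ 0 → IsLocExponent h g t (i, n, μ) σ q w) :
    ∃ x ∈ locComponent K d (overXGrading K d b c (freeGrading K d h g t) i n) σ μ,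
      locToLaurent r σ x = y := by
  classical
  let y' : Fin r → Laurent K d b c := y
  have hsum : y' = ∑ q, ∑ w ∈ (y' q).coeff.support,
      (Pi.single q (AddMonoidAlgebra.single w ((y' q).coeff w)) : Fin r → Laurent K d b c) := by
    conv_lhs => rw [← Finset.univ_sum_single y']
    refine Finset.sum_congr rfl fun q _ => ?_
    conv_lhs => rw [← AddMonoidAlgebra.sum_coeff_single (y' q)]
    exact map_sum (AddMonoidHom.single (fun _ : Fin r => Laurent K d b c) q) _ _
  let H := (locComponent K d (overXGrading K d b c (freeGrading K d h g t) i n) σ μ).map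
    (locToLaurent (K := K) (b := b) (c := c) r σ).toAddMonoidHom
  have : y' ∈ (H : AddSubgroup (Fin r → Laurent K d b c)) := by
    rw [hsum]
    refine sum_mem fun q _ => sum_mem fun w hw => ?_
    exact exists_locToLaurent_eq_single (hy q w (Finsupp.mem_support_iff.1 hw)) _
  exact this

open Classical in
/-- A variable whose exponent is nonnegative, if there is one. -/
def pivot (w : Fin d ⊕ Fin b ⊕ Fin c →₀ ℤ) : Option (Fin d) :=
  if hw : ∃ k, 0 ≤ w (.inl k) then some hw.choose else none

theorem nonneg_of_pivot_eq_some {w : Fin d ⊕ Fin b ⊕ Fin c →₀ ℤ} {j : Fin d}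
    (hj : pivot w = some j) : 0 ≤ w (.inl j) := by
  unfold pivot at hj
  split_ifs at hj with hw
  cases hj
  exact hw.choose_spec

theorem neg_of_pivot_eq_none {w : Fin d ⊕ Fin b ⊕ Fin c →₀ ℤ} (hw : pivot w = none) (k : Fin d) :
    w (.inl k) < 0 := by
  unfold pivot at hw
  split_ifs at hw with hw'
  push Not at hw'
  exact hw' k

open Classical in
/-- The contraction that treats each monomial with its own pivot. -/
def pivotCone (f : Finset (Fin d) → OverX K d b c (Fin r → Laurent K d b c))
    (σ : Finset (Fin d)) : OverX K d b c (Fin r → Laurent K d b c) :=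
  fun q => ∑ j : Fin d, AddMonoidAlgebra.ofCoeff
    (Finsupp.filter (fun w => pivot w = some j) ((cone j f σ : Fin r → Laurent K d b c) q).coeff)

theorem laurentCoeff_pivotCone_of_none
    (f : Finset (Fin d) → OverX K d b c (Fin r → Laurent K d b c)) (σ : Finset (Fin d)) (q : Fin r)
    {w : Fin d ⊕ Fin b ⊕ Fin c →₀ ℤ} (hw : pivot w = none) :
    laurentCoeff q w (pivotCone f σ) = 0 := by
  classical
  change (AddMonoidAlgebra.coeff (∑ j : Fin d, _)) w = 0
  rw [AddMonoidAlgebra.coeff_sum, Finsupp.finsetSum_apply]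
  refine Finset.sum_eq_zero fun j _ => ?_
  rw [AddMonoidAlgebra.coeff_ofCoeff, Finsupp.filter_apply_neg]
  simp [hw]

theorem laurentCoeff_pivotCone_of_some
    (f : Finset (Fin d) → OverX K d b c (Fin r → Laurent K d b c)) (σ : Finset (Fin d)) (q : Fin r)
    {w : Fin d ⊕ Fin b ⊕ Fin c →₀ ℤ} {j : Fin d} (hw : pivot w = some j) :
    laurentCoeff q w (pivotCone f σ) = cone j (fun ρ => laurentCoeff q w (f ρ)) σ := by
  classical
  change (AddMonoidAlgebra.coeff (∑ j : Fin d, _)) w = _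
  rw [AddMonoidAlgebra.coeff_sum, Finsupp.finsetSum_apply, Finset.sum_eq_single_of_mem j
    (Finset.mem_univ j)]
  · refine (Finsupp.filter_apply_pos (fun w => pivot w = some j) _ hw).trans ?_
    change laurentCoeff q w (cone j f σ) = _
    unfold cone
    split_ifs
    · exact map_zero _
    · exact map_zsmul _ _ _
  · intro k _ hk
    rw [AddMonoidAlgebra.coeff_ofCoeff, Finsupp.filter_apply_neg]
    rw [hw]
    exact fun h => hk (Option.some.inj h).symm

/-- The Čech complex of a graded free module is acyclic above the degrees of its generators. -/
theorem cechAcyclic_free {g₁ h₁ : ℤ} (hh : ∀ j, h j ≤ h₁) (hg : ∀ k, g k ≤ g₁) {p : ℕ}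
    (ht : ∀ q, (t q).2.2 - g₁ * (t q).1 - h₁ * (t q).2.1 + (g₁ * i + h₁ * n) < μ + p) :
    CechAcyclic K d (overXGrading K d b c (freeGrading K d h g t) i n) p μ := by
  intro x hx hdx
  set f := cochainFamily (fun σ => (locToLaurent (K := K) (b := b) (c := c) r σ).toAddMonoidHom) x
    with hf
  rw [mem_cechComponent] at hx
  have hexp : ∀ σ q w, laurentCoeff q w (f σ) ≠ 0 → IsLocExponent h g t (i, n, μ) σ q w ∧
      σ.card = p := by
    intro σ q w hw
    by_cases hσ : σ.card = p
    · rw [hf, cochainFamily_of_card _ _ hσ] at hw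
      exact ⟨isLocExponent_of_laurentCoeff_ne_zero (hx ⟨σ, hσ⟩) hw, hσ⟩
    · rw [hf, cochainFamily_of_card_ne _ _ hσ, map_zero] at hw
      exact absurd rfl hw
  -- The degree bound `ht` is used only here, to exclude exponents that are negative in every `X_k`.
  have hpivot : ∀ σ q w, laurentCoeff q w (f σ) ≠ 0 → ∃ j, pivot w = some j := by
    intro σ q w hw
    obtain ⟨he, hσ⟩ := hexp σ q w hw
    by_contra! H
    have hneg := neg_of_pivot_eq_none (Option.eq_none_iff_forall_ne_some.2 H)
    -- A negative exponent of `X_k` requires `X_k` to be inverted, so only the last Čech term can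
    -- contain `w`.
    have hσu : σ = Finset.univ := Finset.eq_univ_of_forall fun k => by
      by_contra hk
      exact absurd (he.nonneg_inl k hk) (not_le.2 (hneg k))
    have hpd : p = d := by rw [← hσ, hσu, Finset.card_univ, Fintype.card_fin]
    have hwt := he.weight
    rw [Finsupp.weight_apply, Finsupp.sum_fintype _ _ (by simp), Fintype.sum_sum_type,
      Fintype.sum_sum_type] at hwt
    have h1 := congrArg (fun ν : ℤ × ℤ × ℤ => ν.1) hwt
    have h2 := congrArg (fun ν : ℤ × ℤ × ℤ => ν.2.1) hwt
    have h3 := congrArg (fun ν : ℤ × ℤ × ℤ => ν.2.2) hwt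
    simp only [triDegree, Prod.fst_add, Prod.snd_add, Prod.fst_sum, Prod.snd_sum, Prod.smul_fst,
      Prod.smul_snd, Prod.fst_sub, Prod.snd_sub, smul_eq_mul, mul_zero, mul_one,
      Finset.sum_const_zero, zero_add, add_zero] at h1 h2 h3
    -- Integers that are negative are at most `-1`; this gives the `-d` that offsets `p = d` in
    -- `ht`.
    have hX : ∑ k : Fin d, w (.inl k) ≤ -d := by
      have : ∑ k : Fin d, w (.inl k) ≤ ∑ _k : Fin d, (-1 : ℤ) :=
        Finset.sum_le_sum fun k _ => by have := hneg k; omega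
      simpa using this
    have hY : ∑ k : Fin b, w (.inr (.inl k)) * h k ≤ (∑ k : Fin b, w (.inr (.inl k))) * h₁ := by
      rw [Finset.sum_mul]
      exact Finset.sum_le_sum fun k _ => mul_le_mul_of_nonneg_left (hh k) (he.nonneg_inr _)
    have hZ : ∑ k : Fin c, w (.inr (.inr k)) * g k ≤ (∑ k : Fin c, w (.inr (.inr k))) * g₁ := by
      rw [Finset.sum_mul]
      exact Finset.sum_le_sum fun k _ => mul_le_mul_of_nonneg_left (hg k) (he.nonneg_inr _)
    rw [h2] at hY
    rw [h1] at hZ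
    have := ht q
    rw [hpd] at this
    linarith
  have hcocycle : ∀ (τ : Finset (Fin d)), τ.card = p + 1 → altSum f τ = 0 := by
    intro τ hτ
    rw [hf, ← map_cechD_apply (τ₀ := Finset.univ) _
      (fun σ τ hστ _ y => locToLaurent_liftOfLE _ y) x hτ (Finset.subset_univ τ), hdx]
    exact map_zero _
  -- The pivot depends on `w` but not on `σ`, so for each coefficient one fixed cone contraction
  -- applies over all subsets.
  have hcone : ∀ τ : Finset (Fin d), τ.card = p → altSum (pivotCone f) τ = f τ := by
    intro τ hτ
    refine laurent_ext fun q w => ?_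
    rw [map_altSum]
    cases hw : pivot w with
    | none =>
      have : laurentCoeff q w (f τ) = 0 := by
        by_contra hne
        obtain ⟨j, hj⟩ := hpivot τ q w hne
        rw [hw] at hj; cases hj
      rw [this, altSum]
      exact Finset.sum_eq_zero fun i _ => by
        rw [laurentCoeff_pivotCone_of_none f _ q hw, smul_zero]
    | some j =>
      rw [altSum_congr fun i _ => laurentCoeff_pivotCone_of_some f _ q hw, altSum_cone]
      intro hj
      rw [← map_altSum, hcocycle _ (by rw [Finset.card_insert_of_notMem hj, hτ]), map_zero]
  cases p with
  | zero =>
    refine AddSubgroup.mem_bot.2 (funext fun σ => locToLaurent_injective σ.1 ?_)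
    have h0 := hcone σ.1 σ.2
    have h1 : altSum (pivotCone f) σ.1 = 0 := by
      rw [altSum, Finset.card_eq_zero.1 σ.2, Finset.sum_empty]
    rw [h1, hf, cochainFamily_of_card _ _ σ.2] at h0
    exact h0.symm.trans (map_zero _).symm
  | succ p =>
    have hy : ∀ ρ : {ρ : Finset (Fin d) // ρ.card = p},
        ∃ y ∈ locComponent K d (overXGrading K d b c (freeGrading K d h g t) i n) ρ.1 μ,
          locToLaurent r ρ.1 y = pivotCone f ρ.1 := by
      rintro ⟨ρ, hρ⟩
      refine exists_locToLaurent_eq _ fun q w hne => ?_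
      cases hw : pivot w with
      | none => exact absurd (laurentCoeff_pivotCone_of_none f ρ q hw) hne
      | some j =>
        rw [laurentCoeff_pivotCone_of_some f ρ q hw, cone] at hne
        split_ifs at hne with hj
        · exact absurd rfl hne
        -- The exponent comes from the localization at `insert j ρ`, but its entry at the pivot `j`
        -- is nonnegative, so it already occurs over `ρ`. The primitive therefore lies in the Čech
        -- complex.
        · have he := (hexp _ q w fun h0 => hne (by rw [h0, smul_zero])).1
          refine ⟨he.weight, fun k hk => ?_, he.nonneg_inr⟩
          rcases eq_or_ne k j with rfl | hkj
          · exact nonneg_of_pivot_eq_some hw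
          · exact he.nonneg_inl k (by simp [hk, hkj])
    choose y hy hye using hy
    refine ⟨y, mem_cechComponent.2 hy, funext fun τ => locToLaurent_injective τ.1 ?_⟩
    have h1 := map_cechD_apply (τ₀ := Finset.univ)
      (fun σ => (locToLaurent (K := K) (b := b) (c := c) r σ).toAddMonoidHom)
      (fun σ τ hστ _ y => locToLaurent_liftOfLE _ y) y τ.2 (Finset.subset_univ τ.1)
    refine h1.trans ((altSum_congr fun k hk => ?_).trans ((hcone τ.1 τ.2).trans ?_))
    · have hc : (τ.1.erase k).card = p := by
        rw [Finset.card_erase_of_mem hk, τ.2, Nat.add_sub_cancel]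
      rw [cochainFamily_of_card _ _ hc]
      exact hye ⟨τ.1.erase k, hc⟩
    · rw [hf, cochainFamily_of_card _ _ τ.2]; rfl

end FreeAcyclic

/-! ### Homogeneous components in graded free modules -/

section FreeDecomposition

variable {K : Type*} [Field K] {d b c r : ℕ} (h : Fin b → ℤ) (g : Fin c → ℤ)
  (t : Fin r → ℤ × ℤ × ℤ)

theorem mem_iSup_freeGrading (f : Fin r → TriPoly K d b c) :
    f ∈ ⨆ ν, freeGrading K d h g t ν := by
  classical
  rw [← Finset.univ_sum_single f]
  refine sum_mem fun q _ => ?_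
  induction f q using MvPolynomial.induction_on' with
  | monomial v a =>
    refine AddSubgroup.mem_iSup_of_mem (Finsupp.weight (triDegree d h g) v + t q) fun q' => ?_
    rcases eq_or_ne q' q with rfl | hq
    · rw [Pi.single_eq_same, add_sub_cancel_right]
      exact isWeightedHomogeneous_monomial _ _ _ rfl
    · rw [Pi.single_eq_of_ne hq]; exact zero_mem _
  | add x y hx hy => rw [Pi.single_add]; exact add_mem hx hy

variable (K d) in
/-- The degree `ν` component of an element of a graded free module. -/
def freeProj (ν : ℤ × ℤ × ℤ) : (Fin r → TriPoly K d b c) →+ (Fin r → TriPoly K d b c) where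
  toFun f q := weightedHomogeneousComponent (triDegree d h g) (ν - t q) (f q)
  map_zero' := funext fun _ => map_zero _
  map_add' _ _ := funext fun _ => map_add _ _ _

theorem freeProj_mem (ν : ℤ × ℤ × ℤ) (f : Fin r → TriPoly K d b c) :
    freeProj K d h g t ν f ∈ freeGrading K d h g t ν :=
  fun _ => weightedHomogeneousComponent_isWeightedHomogeneous _ _

variable {h g t}

theorem freeProj_of_mem {ν : ℤ × ℤ × ℤ} {f : Fin r → TriPoly K d b c}
    (hf : f ∈ freeGrading K d h g t ν) : freeProj K d h g t ν f = f :=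
  funext fun q => (hf q).weightedHomogeneousComponent_same

theorem freeProj_of_mem_ne {ν ν' : ℤ × ℤ × ℤ} (hν : ν' ≠ ν) {f : Fin r → TriPoly K d b c}
    (hf : f ∈ freeGrading K d h g t ν') : freeProj K d h g t ν f = 0 :=
  funext fun q => (hf q).weightedHomogeneousComponent_ne _ fun H => hν (sub_left_inj.1 H).symm

/-- A homogeneous map out of a graded free module commutes with taking components. -/
theorem map_freeProj {A : Type*} [AddCommGroup A] {𝓐 : ℤ × ℤ × ℤ → AddSubgroup A}
    {θ : (Fin r → TriPoly K d b c) →+ A} {ν : ℤ × ℤ × ℤ} {π : A →+ A}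
    (hθ : ∀ ν, ∀ f ∈ freeGrading K d h g t ν, θ f ∈ 𝓐 ν)
    (hπ : ∀ x ∈ 𝓐 ν, π x = x) (hπ' : ∀ ν', ν' ≠ ν → ∀ x ∈ 𝓐 ν', π x = 0)
    (f : Fin r → TriPoly K d b c) : θ (freeProj K d h g t ν f) = π (θ f) := by
  induction mem_iSup_freeGrading h g t f using AddSubgroup.iSup_induction' with
  | hp ν' f hf =>
    rcases eq_or_ne ν' ν with rfl | hν
    · rw [freeProj_of_mem hf, hπ _ (hθ _ _ hf)]
    · rw [freeProj_of_mem_ne hν hf, hπ' _ hν _ (hθ _ _ hf), map_zero]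
  | h1 => simp
  | hadd x y _ _ hx hy => simp only [map_add, hx, hy]

end FreeDecomposition

/-! ### Dimension shifting along the resolution -/

namespace GradedFreeResolution

variable {K : Type*} [Field K] {d b c : ℕ} {h : Fin b → ℤ} {g : Fin c → ℤ}
  {L : Type*} [AddCommGroup L] [Module (TriPoly K d b c) L] {𝓛 : ℤ × ℤ × ℤ → AddSubgroup L}
  (F : GradedFreeResolution K d h g 𝓛)

/-- The grading of the `l`-th module of the resolution. -/
abbrev grading (l : ℕ) (ν : ℤ × ℤ × ℤ) : AddSubgroup (Fin (F.rank l) → TriPoly K d b c) :=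
  freeGrading K d h g (F.twist l) ν

/-- The component of degree `ν` of any preimage is again a preimage, because `φ` commutes with
taking components. The same argument serves `exists_ε_eq`. -/
theorem exists_φ_eq (l : ℕ) {ν : ℤ × ℤ × ℤ} {f : Fin (F.rank l) → TriPoly K d b c}
    (hf : f ∈ F.grading l ν) (hφ : f ∈ Set.range (F.φ l)) :
    ∃ f' ∈ F.grading (l + 1) ν, F.φ l f' = f := by
  obtain ⟨e, rfl⟩ := hφ
  refine ⟨freeProj K d h g _ ν e, freeProj_mem _ _ _ _ _, ?_⟩
  exact (map_freeProj (𝓐 := F.grading l) (θ := (F.φ l).toAddMonoidHom) (F.φ_homogeneous l)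
    (fun _ => freeProj_of_mem) (fun _ hν _ => freeProj_of_mem_ne hν) e).trans (freeProj_of_mem hf)

theorem exists_ε_eq [DirectSum.Decomposition 𝓛] {ν : ℤ × ℤ × ℤ} {x : L} (hx : x ∈ 𝓛 ν) :
    ∃ f ∈ F.grading 0 ν, F.ε f = x := by
  obtain ⟨e, rfl⟩ := F.surjective_ε x
  refine ⟨freeProj K d h g _ ν e, freeProj_mem _ _ _ _ _, ?_⟩
  let π : L →+ L :=
    { toFun := fun x => DirectSum.decompose 𝓛 x ν
      map_zero' := by simp
      map_add' := by simp }
  exact (map_freeProj (θ := F.ε.toAddMonoidHom) (π := π) F.ε_homogeneous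
    (fun _ hx => DirectSum.decompose_of_mem_same 𝓛 hx)
    (fun _ hν _ hx => DirectSum.decompose_of_mem_ne 𝓛 hx hν) e).trans
    (DirectSum.decompose_of_mem_same 𝓛 hx)

section Chase

variable {i n μ h₁ g₁ : ℤ} {p : ℕ} (hh : ∀ j, h j ≤ h₁) (hg : ∀ k, g k ≤ g₁)
  (hF : ∀ l q, (F.twist l q).2.2 - g₁ * (F.twist l q).1 - h₁ * (F.twist l q).2.1 - l +
    (g₁ * i + h₁ * n) < μ + p)

include hh hg hF

theorem cechAcyclic_grading (l : ℕ) :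
    CechAcyclic K d (overXGrading K d b c (F.grading l) i n) (p + l) μ := by
  refine cechAcyclic_free hh hg fun q => ?_
  have := hF l q
  push_cast
  linarith

/-- Vanishing of `H^{p+l+1}` of the image of `φ l` in degree `μ`, by descending induction on `l`;
`k` bounds the distance to the end of the resolution, where `F_{l+1} = 0`. -/
theorem exists_cechMap_φ_eq (k : ℕ) : ∀ l, F.length ≤ l + k →
    ∀ x ∈ cechComponent K d (overXGrading K d b c (F.grading (l + 1)) i n) (p + (l + 1)) μ,
    cechMap (overXMap (F.φ l)) (p + (l + 1) + 1) (cechD K d _ (p + (l + 1)) x) = 0 →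
    ∃ y ∈ gradedCoboundary K d (overXGrading K d b c (F.grading (l + 1)) i n) μ (p + (l + 1)),
      cechMap (overXMap (F.φ l)) (p + (l + 1)) x = cechMap (overXMap (F.φ l)) (p + (l + 1)) y := by
  induction k with
  | zero =>
    intro l hl x _ _
    refine ⟨0, zero_mem _, ?_⟩
    have hr : F.rank (l + 1) = 0 := F.rank_eq_zero _ (by omega)
    have : IsEmpty (Fin (F.rank (l + 1))) := by rw [hr]; infer_instance
    have hx : x = 0 := by
      funext σ
      generalize x σ = z
      induction z using LocalizedModule.induction_on with
      | h m s =>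
        have : m = 0 := funext fun q : Fin (F.rank (l + 1)) => isEmptyElim q
        rw [this, LocalizedModule.zero_mk]; rfl
    rw [hx]
  | succ k ih =>
    intro l hl x hx hφ
    obtain ⟨y, hy, z, _, rfl⟩ := cech_decomposition_step (φ := overXMap (F.φ (l + 1)))
      (isMonomialGraded_overXGrading h g (F.grading (l + 2)) i n)
      (isMonomialGraded_overXGrading h g (F.grading (l + 1)) i n)
      (fun a m hm => F.φ_homogeneous (l + 1) (i, n, a) m hm)
      (fun a m hm hm' => F.exists_φ_eq (l + 1) hm ((F.exact_φ l m).1 hm'))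
      (F.cechAcyclic_grading hh hg hF (l + 1)) (ih (l + 1) (by omega)) hx hφ
    refine ⟨y, hy, ?_⟩
    rw [map_add, cechMap_comp_eq_zero, add_zero]
    exact (F.exact_φ l).apply_apply_eq_zero

/-- A cocycle of `L` is lifted to `F_0`. The lift is a coboundary plus a cochain coming from `F_1`,
and `ε` kills the latter. -/
theorem cechAcyclic [DirectSum.Decomposition 𝓛] [SetLike.GradedSMul (triGrading K d h g) 𝓛] :
    CechAcyclic K d (overXGrading K d b c 𝓛 i n) p μ := by
  intro x hx hdx
  obtain ⟨w, hw, rfl⟩ := exists_cechMap_eq_of_surjective (φ := overXMap F.ε)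
    (isMonomialGraded_overXGrading h g 𝓛 i n) (fun a m hm => F.exists_ε_eq hm) hx
  obtain ⟨y, hy, z, _, rfl⟩ := cech_decomposition_step (φ := overXMap (F.φ 0))
    (ψ := overXMap F.ε)
    (isMonomialGraded_overXGrading h g (F.grading 1) i n)
    (isMonomialGraded_overXGrading h g (F.grading 0) i n)
    (fun a m hm => F.φ_homogeneous 0 (i, n, a) m hm)
    (fun a m hm hm' => F.exists_φ_eq 0 hm ((F.exact_ε m).1 hm'))
    (F.cechAcyclic_grading hh hg hF 0)
    (F.exists_cechMap_φ_eq hh hg hF F.length 0 (by omega)) hw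
    ((cechMap_cechD _ _).trans hdx)
  have h0 : cechMap (overXMap F.ε) p (cechMap (overXMap (F.φ 0)) p z) = 0 :=
    cechMap_comp_eq_zero F.exact_ε.apply_apply_eq_zero z
  refine (congrArg (· ∈ _) ((map_add _ _ _).trans ((congrArg _ h0).trans (add_zero _)))).mpr ?_
  exact cechMap_mem_gradedCoboundary (isMonomialGraded_overXGrading h g (F.grading 0) i n)
    (fun a m hm => F.ε_homogeneous (i, n, a) m hm) hy

end Chase

end GradedFreeResolution

/-! ### Passage to the strand and to the regularity -/

section Strand

variable {K : Type*} [Field K] {d b c : ℕ} (h : Fin b → ℤ) (g : Fin c → ℤ)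
  {L : Type*} [AddCommGroup L] [Module (TriPoly K d b c) L] (𝓛 : ℤ × ℤ × ℤ → AddSubgroup L)
  [SetLike.GradedSMul (triGrading K d h g) 𝓛] (i n : ℤ)

/-- The inclusion of a strand. -/
def strandSubtype : Strand K d h g 𝓛 i n →ₗ[MvPolynomial (Fin d) K] OverX K d b c L where
  toFun x := x.1
  map_add' _ _ := rfl
  map_smul' _ _ := rfl

theorem isMonomialGraded_strandGrading :
    IsMonomialGraded K d (strandGrading K d h g 𝓛 i n) := fun u a m hm =>
  isMonomialGraded_overXGrading h g 𝓛 i n u a (strandSubtype h g 𝓛 i n m) hm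

/-- The chase takes place in the whole of `L`, with only the pieces `𝓛 (i, n, a)` as grading. The
strand has the same pieces, so acyclicity descends along the inclusion. -/
theorem cechAcyclic_strandGrading {p : ℕ} {μ : ℤ}
    (H : CechAcyclic K d (overXGrading K d b c 𝓛 i n) p μ) :
    CechAcyclic K d (strandGrading K d h g 𝓛 i n) p μ :=
  H.of_injective (φ := strandSubtype h g 𝓛 i n) (isMonomialGraded_strandGrading h g 𝓛 i n)
    (isMonomialGraded_overXGrading h g 𝓛 i n) (fun _ _ => Subtype.ext) (fun _ _ hm => hm)
    (fun a m hm => ⟨⟨m, AddSubgroup.mem_iSup_of_mem (S := fun a => 𝓛 (i, n, a)) a hm⟩, hm, rfl⟩)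

end Strand

theorem reg_le {K : Type*} [Field K] {d : ℕ} {M : Type*} [AddCommGroup M]
    [Module (MvPolynomial (Fin d) K) M] {𝓜 : ℤ → AddSubgroup M} {B : EReal}
    (H : ∀ (p : ℕ) (μ : ℤ), B < ((μ + p : ℤ) : ℝ) → localCohomologyComponent K d 𝓜 p μ = ⊥) :
    reg K d 𝓜 ≤ B := by
  refine iSup_le fun p => ?_
  rw [← EReal.le_sub_iff_add_le (.inl (EReal.natCast_ne_bot p)) (.inl (EReal.natCast_ne_top p))]
  refine iSup₂_le fun μ hμ => ?_
  rw [EReal.le_sub_iff_add_le (.inl (EReal.natCast_ne_bot p)) (.inl (EReal.natCast_ne_top p))]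
  by_contra! hlt
  refine hμ (H p μ ?_)
  push_cast
  exact hlt

/-- Turns the strict inequality in `EReal`, where `e` may be `-∞`, into integer inequalities, one
for each generator. -/
theorem GradedFreeResolution.twist_lt {K : Type*} [Field K] {d b c : ℕ} {h : Fin b → ℤ}
    {g : Fin c → ℤ} {L : Type*} [AddCommGroup L] [Module (TriPoly K d b c) L]
    {𝓛 : ℤ × ℤ × ℤ → AddSubgroup L} (F : GradedFreeResolution K d h g 𝓛) {g₁ h₁ z a : ℤ}
    (H : ((z : ℝ) : EReal) + F.eInvariant g₁ h₁ < ((a : ℤ) : ℝ)) (l : ℕ) (q : Fin (F.rank l)) :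
    (F.twist l q).2.2 - g₁ * (F.twist l q).1 - h₁ * (F.twist l q).2.1 - l + z < a := by
  -- The generator `q` shows that `F_l` is nonzero, so `l` is among the indices over which `e` is
  -- the maximum.
  have hl : l < F.length + 1 := by
    by_contra! hl
    exact (Fin.cast (F.rank_eq_zero l hl) q).elim0
  have h1 : (((F.twist l q).2.2 - g₁ * (F.twist l q).1 - h₁ * (F.twist l q).2.1 : ℤ) : ℝ) ≤
      F.cInvariant g₁ h₁ l :=
    Finset.le_sup (f := fun p : Fin (F.rank l) => ((((F.twist l p).2.2 - g₁ * (F.twist l p).1 -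
      h₁ * (F.twist l p).2.1 : ℤ) : ℝ) : EReal)) (Finset.mem_univ q)
  have h2 : F.cInvariant g₁ h₁ l - (l : EReal) ≤ F.eInvariant g₁ h₁ :=
    Finset.le_sup (f := fun l : ℕ => F.cInvariant g₁ h₁ l - (l : EReal)) (Finset.mem_range.2 hl)
  have h3 := (add_le_add_right ((EReal.sub_le_sub h1 le_rfl).trans h2) ((z : ℝ) : EReal)).trans_lt H
  rw [← EReal.coe_coe_eq_natCast, ← EReal.coe_sub, ← EReal.coe_add, EReal.coe_lt_coe_iff] at h3
  have h4 : (z : ℝ) + (((F.twist l q).2.2 - g₁ * (F.twist l q).1 - h₁ * (F.twist l q).2.1 : ℤ) -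
    (l : ℤ)) < a := by exact_mod_cast h3
  have h5 : z + ((F.twist l q).2.2 - g₁ * (F.twist l q).1 - h₁ * (F.twist l q).2.1 - l) < a := by
    exact_mod_cast h4
  linarith

end Multigraded

end

/-- `h₁` and `g₁` are the first terms of the weakly decreasing families `h` and `g`; if there are
no variables `Y_j` (resp. `Z_k`), then `h₁` (resp. `g₁`) is an arbitrary integer. -/
theorem theorem4p3 {K : Type*} [Field K] {d b c : ℕ}
    (h : Fin b → ℤ) (g : Fin c → ℤ) (h_anti : Antitone h) (g_anti : Antitone g)
    (h₁ g₁ : ℤ) (hh₁ : ∀ hb : 0 < b, h₁ = h ⟨0, hb⟩) (hg₁ : ∀ hc : 0 < c, g₁ = g ⟨0, hc⟩)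
    {L : Type*} [AddCommGroup L] [Module (Multigraded.TriPoly K d b c) L]
    [Module.Finite (Multigraded.TriPoly K d b c) L]
    (𝓛 : ℤ × ℤ × ℤ → AddSubgroup L) [DirectSum.Decomposition 𝓛]
    [SetLike.GradedSMul (Multigraded.triGrading K d h g) 𝓛]
    (F : Multigraded.GradedFreeResolution K d h g 𝓛) (i n : ℤ) :
    Multigraded.reg K d (Multigraded.strandGrading K d h g 𝓛 i n) ≤
      ((g₁ * i + h₁ * n : ℤ) : ℝ) + F.eInvariant g₁ h₁ := by
  have hh : ∀ j, h j ≤ h₁ := fun j => by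
    rw [hh₁ j.pos]; exact h_anti (Fin.mk_le_of_le_val (Nat.zero_le _))
  have hg : ∀ k, g k ≤ g₁ := fun k => by
    rw [hg₁ k.pos]; exact g_anti (Fin.mk_le_of_le_val (Nat.zero_le _))
  refine Multigraded.reg_le fun p μ hμ => ?_
  exact (Multigraded.cechAcyclic_strandGrading h g 𝓛 i n
    (F.cechAcyclic hh hg (F.twist_lt hμ))).localCohomologyComponent_eq_bot
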